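/- Notation. A \emph{pseudoreflection} of $\mathbb{R}^n$ is a linear map $\mathbb{R}^n\to\mathbb{R}^n$ whose fixed point subspace has codimension two. Let $\mathbf{I}$ be the binary icosahedral group, that is, the group of all unit quaternions $q$ for which the rotation $v\mapsto qvq^{-1}$ of the space of purely imaginary quaternions (identified with $\mathbb{R}^3$) maps the regular icosahedron with vertices $(0,\pm1,\pm\tau),(\pm1,\pm\tau,0),(\pm\tau,0,\pm1)$, $\tau=\frac{1+\sqrt5}{2}$, onto itself. A subgroup $P<SO(4)$ is called a \emph{Poincar\'e group} if there is a linear isometry $f:\mathbb{H}\to\mathbb{R}^4$ such that $P=\{\,f\circ\ell_q\circ f^{-1} : q\in\mathbf{I}\,\}$, where $\ell_q(x)=qx$ is left multiplication by $q$ on the quaternions $\mathbb{H}$. Lemma. Let $\Gamma<SO(4)$ be a finite subgroup, and let $\Gamma_{ps}\triangleleft\Gamma$ be the normal subgroup generated by the pseudoreflections contained in $\Gamma$. If $\Gamma/\Gamma_{ps}$ is isomorphic to $SL_2(p)=SL_2(\mathbb{Z}/p\mathbb{Z})$ for some prime $p>3$, then $p=5$ and $\Gamma$ is a Poincar\'e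 group. -/

import Mathlib

open scoped Quaternion

/-- A pseudoreflection of `ℝⁿ`: a linear endomorphism whose fixed point subspace has
codimension two. -/
def IsPseudoreflection {n : ℕ}
    (g : EuclideanSpace ℝ (Fin n) →ₗ[ℝ] EuclideanSpace ℝ (Fin n)) : Prop :=
  Module.finrank ℝ (LinearMap.eqLocus g LinearMap.id) + 2 = n

/-- The pseudoreflections contained in a subgroup `Γ` of `SO(n)`. -/
def pseudoreflectionSet {n : ℕ} (Γ : Subgroup (Matrix.specialOrthogonalGroup (Fin n) ℝ)) :
    Set Γ :=
  {g | IsPseudoreflection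
    (Matrix.toEuclideanLin ((g : Matrix.specialOrthogonalGroup (Fin n) ℝ) :
      Matrix (Fin n) (Fin n) ℝ))}

/-- The subgroup `Γ_ps` of `Γ` generated by the pseudoreflections contained in `Γ`. -/
def psSubgroup {n : ℕ} (Γ : Subgroup (Matrix.specialOrthogonalGroup (Fin n) ℝ)) :
    Subgroup Γ :=
  Subgroup.closure (pseudoreflectionSet Γ)

theorem toEuclideanLin_one_apply {n : ℕ} (x : EuclideanSpace ℝ (Fin n)) :
    Matrix.toEuclideanLin (1 : Matrix (Fin n) (Fin n) ℝ) x = x := by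
  simp

theorem toEuclideanLin_mul_apply {n : ℕ} (A B : Matrix (Fin n) (Fin n) ℝ)
    (x : EuclideanSpace ℝ (Fin n)) :
    Matrix.toEuclideanLin (A * B) x = Matrix.toEuclideanLin A (Matrix.toEuclideanLin B x) := by
  simp [Matrix.toLpLin_apply]

theorem conj_mem_pseudoreflectionSet {n : ℕ}
    (Γ : Subgroup (Matrix.specialOrthogonalGroup (Fin n) ℝ)) (h g : Γ)
    (hg : g ∈ pseudoreflectionSet Γ) : h * g * h⁻¹ ∈ pseudoreflectionSet Γ := by
  let m : Γ → Matrix (Fin n) (Fin n) ℝ :=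
    fun a => ((a : Matrix.specialOrthogonalGroup (Fin n) ℝ) : Matrix (Fin n) (Fin n) ℝ)
  have hm : ∀ a b : Γ, m (a * b) = m a * m b := fun a b => rfl
  have hm1 : m 1 = 1 := rfl
  have hl : ∀ x, Matrix.toEuclideanLin (m h⁻¹) (Matrix.toEuclideanLin (m h) x) = x := by
    intro x
    rw [← toEuclideanLin_mul_apply, ← hm, inv_mul_cancel, hm1, toEuclideanLin_one_apply]
  have hr : ∀ x, Matrix.toEuclideanLin (m h) (Matrix.toEuclideanLin (m h⁻¹) x) = x := by
    intro x
    rw [← toEuclideanLin_mul_apply, ← hm, mul_inv_cancel, hm1, toEuclideanLin_one_apply]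
  let e : EuclideanSpace ℝ (Fin n) ≃ₗ[ℝ] EuclideanSpace ℝ (Fin n) :=
    LinearEquiv.ofLinearMap (Matrix.toEuclideanLin (m h)) (Matrix.toEuclideanLin (m h⁻¹))
      (LinearMap.ext hr) (LinearMap.ext hl)
  have key : LinearMap.eqLocus (Matrix.toEuclideanLin (m (h * g * h⁻¹))) LinearMap.id =
      (LinearMap.eqLocus (Matrix.toEuclideanLin (m g)) LinearMap.id).map
        (e : EuclideanSpace ℝ (Fin n) →ₗ[ℝ] EuclideanSpace ℝ (Fin n)) := by
    ext x
    rw [Submodule.mem_map]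
    constructor
    · intro hx
      refine ⟨Matrix.toEuclideanLin (m h⁻¹) x, ?_, hr x⟩
      have hx' : Matrix.toEuclideanLin (m (h * g * h⁻¹)) x = x := hx
      rw [hm, hm, toEuclideanLin_mul_apply, toEuclideanLin_mul_apply] at hx'
      change Matrix.toEuclideanLin (m g) (Matrix.toEuclideanLin (m h⁻¹) x) =
        Matrix.toEuclideanLin (m h⁻¹) x
      conv_rhs => rw [← hx', hl]
    · rintro ⟨y, hy, rfl⟩
      have hy' : Matrix.toEuclideanLin (m g) y = y := hy
      change Matrix.toEuclideanLin (m (h * g * h⁻¹)) (Matrix.toEuclideanLin (m h) y) =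
        Matrix.toEuclideanLin (m h) y
      rw [hm, hm, toEuclideanLin_mul_apply, toEuclideanLin_mul_apply, hl, hy']
  have hg' : Module.finrank ℝ
      (LinearMap.eqLocus (Matrix.toEuclideanLin (m g)) LinearMap.id) + 2 = n := hg
  change Module.finrank ℝ
      (LinearMap.eqLocus (Matrix.toEuclideanLin (m (h * g * h⁻¹))) LinearMap.id) + 2 = n
  rw [key]
  rw [LinearEquiv.finrank_map_eq e]
  exact hg'

instance psSubgroup_normal {n : ℕ}
    (Γ : Subgroup (Matrix.specialOrthogonalGroup (Fin n) ℝ)) : (psSubgroup Γ).Normal := by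
  constructor
  intro g hg h
  unfold psSubgroup at hg ⊢
  induction hg using Subgroup.closure_induction with
  | mem x hx => exact Subgroup.subset_closure (conj_mem_pseudoreflectionSet Γ h x hx)
  | one => simp
  | mul x y _ _ hx hy =>
    have hxy : h * (x * y) * h⁻¹ = (h * x * h⁻¹) * (h * y * h⁻¹) := by group
    rw [hxy]
    exact mul_mem hx hy
  | inv x _ hx =>
    have hxi : h * x⁻¹ * h⁻¹ = (h * x * h⁻¹)⁻¹ := by group
    rw [hxi]
    exact inv_mem hx

/-- The twelve vertices `(0, ±1, ±τ)`, `(±1, ±τ, 0)`, `(±τ, 0, ±1)` (with `τ` the golden ratio)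
of a regular icosahedron centered at the origin of `ℝ³`, where `ℝ³` is the space of purely
imaginary quaternions. -/
def icosahedronVertices : Set ℍ[ℝ] :=
  {v | ∃ s t : ℝ, (s = 1 ∨ s = -1) ∧ (t = Real.goldenRatio ∨ t = -Real.goldenRatio) ∧
    (v = ⟨0, 0, s, t⟩ ∨ v = ⟨0, s, t, 0⟩ ∨ v = ⟨0, t, 0, s⟩)}

/-- The binary icosahedral group inside the unit quaternions `S³ ≅ SU(2)`: the preimage, under
the covering `S³ → SO(3)` sending `q` to the rotation `v ↦ q v q⁻¹` of the imaginary quaternions,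
of the group of rotations that map the icosahedron onto itself. For a unit quaternion
`q⁻¹ = star q`. -/
def binaryIcosahedralGroup : Subgroup (unitary ℍ[ℝ]) where
  carrier := {q | (fun v : ℍ[ℝ] => (q : ℍ[ℝ]) * v * star (q : ℍ[ℝ])) '' icosahedronVertices =
    icosahedronVertices}
  one_mem' := by simp
  mul_mem' := by
    intro a b ha hb
    simp only [Set.mem_ofPred_eq] at ha hb ⊢
    conv_rhs => rw [← ha, ← hb, Set.image_image]
    simp [mul_assoc]
  inv_mem' := by
    intro a ha
    simp only [Set.mem_ofPred_eq] at ha ⊢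
    have h1 : star (a : ℍ[ℝ]) * (a : ℍ[ℝ]) = 1 := Unitary.coe_star_mul_self a
    conv_lhs => rw [← ha, Set.image_image]
    have h2 : ∀ v : ℍ[ℝ], ((a⁻¹ : unitary ℍ[ℝ]) : ℍ[ℝ]) * ((a : ℍ[ℝ]) * v * star (a : ℍ[ℝ])) *
        star ((a⁻¹ : unitary ℍ[ℝ]) : ℍ[ℝ]) = v := by
      intro v
      have hi : ((a⁻¹ : unitary ℍ[ℝ]) : ℍ[ℝ]) = star (a : ℍ[ℝ]) := rfl
      rw [hi, star_star]
      calc star (a : ℍ[ℝ]) * ((a : ℍ[ℝ]) * v * star (a : ℍ[ℝ])) * (a : ℍ[ℝ])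
          = (star (a : ℍ[ℝ]) * (a : ℍ[ℝ])) * v * (star (a : ℍ[ℝ]) * (a : ℍ[ℝ])) := by
            simp only [mul_assoc]
        _ = v := by rw [h1, one_mul, mul_one]
    simp only [h2, Set.image_id']

/-- A subgroup `Γ < SO(4)` is a Poincaré group if, for some isometric identification `f` of the
quaternions with `ℝ⁴`, it consists exactly of the left multiplications by the elements of the
binary icosahedral group. -/
def IsPoincareGroup (Γ : Subgroup (Matrix.specialOrthogonalGroup (Fin 4) ℝ)) : Prop :=
  ∃ f : ℍ[ℝ] ≃ₗᵢ[ℝ] EuclideanSpace ℝ (Fin 4),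
    ∀ g : Matrix.specialOrthogonalGroup (Fin 4) ℝ,
      g ∈ Γ ↔ ∃ q ∈ binaryIcosahedralGroup, ∀ x : ℍ[ℝ],
        Matrix.toEuclideanLin (g : Matrix (Fin 4) (Fin 4) ℝ) (f x) = f ((q : ℍ[ℝ]) * x)

/-! The map sending a pair (l, r) of unit quaternions to the rotation x ↦ l x r⁻¹ is a double cover
S³ × S³ → SO(4) with kernel ±(1, 1). Let G be the preimage of Γ, with projections L and R to the two
factors; both are finite and contain -1. The pair (l, r) has a nonzero fixed vector x exactly when l
= x r x⁻¹, that is, when l and r have the same real part. So the pseudoreflections of Γ come from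
the pairs with Re l = Re r and l ≠ ±1.

Klein's pole count (`classification`) leaves few finite groups of unit quaternions containing -1:
those with an abelian subgroup of index at most two, those of order 24 or 48, and those of
icosahedral type, of order 120. Write F for the surjection G → S = SL₂(p). Since S is perfect, F
remains surjective on the kernel of any homomorphism to a solvable group
(`Group.IsPerfect.map_ker_eq_top`). Divisibility of |S| by p > 3 then forces p = 5 and makes L or R
icosahedral (`exists_isIcosahedral`). Quaternionic conjugation exchanges the two factors, so L may
be taken icosahedral.

Pseudoreflections cannot occur (`free_of_isIcosahedral_left`). One of them would give ker F a
noncentral image in L, and a normal subgroup of L that contains -1 and a noncentral element has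
index at most three. Hence the part 1 × R₀ of G already maps onto S, R is icosahedral and 1 × R lies
in G. By the same index bound in R, the projection of ker F to R still maps onto S. But conjugation
on 1 × R sees only the second coordinate, so elements of ker F have second coordinates with central
image in S. Thus S would be abelian.

Therefore F has kernel ±(1, 1) and |G| = 240. Comparing real parts shows that R has no element of
order three, so R is solvable, and counting gives G = L × {±1} (`right_trivial_of_free`). So Γ
consists of the left multiplications by L.

Finally L is conjugate to the binary icosahedral group (`IsIcosahedral.exists_conj_eq`): the real
parts available in L determine the angle between two axes of order five, two such rotors can be
moved to rotors of adjacent vertices, and they generate all vertex rotors, whose axes L must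
permute. The conjugating quaternion is absorbed into the isometry f. -/

/-- The group of unit quaternions. -/
abbrev UnitQuat : Type := unitary ℍ[ℝ]

/-! ### Unit quaternions: squares, real parts, centralizers -/

namespace UnitQuat

@[simp] theorem coe_inv (q : UnitQuat) : ((q⁻¹ : UnitQuat) : ℍ[ℝ]) = star (q : ℍ[ℝ]) := rfl

@[simp] theorem coe_neg (q : UnitQuat) : ((-q : UnitQuat) : ℍ[ℝ]) = -(q : ℍ[ℝ]) := rfl

theorem coe_inj {q r : UnitQuat} : (q : ℍ[ℝ]) = r ↔ q = r := Subtype.coe_inj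

theorem sq_sum (q : UnitQuat) :
    q.1.re ^ 2 + q.1.imI ^ 2 + q.1.imJ ^ 2 + q.1.imK ^ 2 = 1 := by
  have h := congrArg QuaternionAlgebra.re (Unitary.coe_star_mul_self q)
  simp only [Quaternion.re_mul, Quaternion.re_star, Quaternion.imI_star,
    Quaternion.imJ_star, Quaternion.imK_star, Quaternion.re_one] at h
  linear_combination h

theorem mem_unitary_of_sq_sum {q : ℍ[ℝ]}
    (h : q.re ^ 2 + q.imI ^ 2 + q.imJ ^ 2 + q.imK ^ 2 = 1) : q ∈ unitary ℍ[ℝ] := by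
  rw [Unitary.mem_iff]
  constructor <;> ext <;>
    simp only [Quaternion.re_mul, Quaternion.imI_mul, Quaternion.imJ_mul, Quaternion.imK_mul,
      Quaternion.re_star, Quaternion.imI_star, Quaternion.imJ_star, Quaternion.imK_star,
      Quaternion.re_one, Quaternion.imI_one, Quaternion.imJ_one, Quaternion.imK_one]
  · linear_combination h
  · ring
  · ring
  · ring
  · linear_combination h
  · ring
  · ring
  · ring

theorem ext_iff' {q r : UnitQuat} : q = r ↔ q.1.re = r.1.re ∧ q.1.imI = r.1.imI ∧
    q.1.imJ = r.1.imJ ∧ q.1.imK = r.1.imK := by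
  rw [← coe_inj, Quaternion.ext_iff]

theorem neg_ne (q : UnitQuat) : -q ≠ q := by
  intro h
  have h1 := sq_sum q
  rw [ext_iff'] at h
  simp only [coe_neg, Quaternion.re_neg, Quaternion.imI_neg, Quaternion.imJ_neg,
    Quaternion.imK_neg] at h
  obtain ⟨h2, h3, h4, h5⟩ := h
  have e2 : q.1.re = 0 := by linarith
  have e3 : q.1.imI = 0 := by linarith
  have e4 : q.1.imJ = 0 := by linarith
  have e5 : q.1.imK = 0 := by linarith
  rw [e2, e3, e4, e5] at h1
  norm_num at h1

theorem sq_eq_one_iff {q : UnitQuat} : q * q = 1 ↔ q = 1 ∨ q = -1 := by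
  constructor
  · intro h
    have h' : (q : ℍ[ℝ]) * q = 1 := congrArg Subtype.val h
    rcases mul_self_eq_one_iff.1 h' with h | h
    · left; exact Subtype.ext h
    · right; exact Subtype.ext h
  · rintro (rfl | rfl) <;> simp

theorem re_conj (g q : UnitQuat) : (g * q * g⁻¹).1.re = q.1.re := by
  have hg := sq_sum g
  simp only [Submonoid.coe_mul, coe_inv, Quaternion.re_mul, Quaternion.imI_mul,
    Quaternion.imJ_mul, Quaternion.imK_mul, Quaternion.re_star, Quaternion.imI_star,
    Quaternion.imJ_star, Quaternion.imK_star]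
  linear_combination q.1.re * hg

theorem mul_self_eq (q : UnitQuat) : (q : ℍ[ℝ]) * q = ((2 * q.1.re : ℝ) : ℍ[ℝ]) * q - 1 := by
  have hg := sq_sum q
  ext
  · simp
    linear_combination -hg
  all_goals
    simp
    ring

theorem mul_self_eq_neg_one_iff {q : UnitQuat} : q * q = -1 ↔ q.1.re = 0 := by
  rw [← coe_inj, Submonoid.coe_mul, mul_self_eq]
  constructor
  · intro h
    simp only [coe_neg, OneMemClass.coe_one, sub_eq_neg_self, mul_eq_zero] at h
    rcases h with h | h
    · have := congrArg QuaternionAlgebra.re h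
      simpa using this
    · simp [h]
  · intro h
    simp [h]

theorem re_sq_eq_one_iff {q : UnitQuat} : q.1.re ^ 2 = 1 ↔ q = 1 ∨ q = -1 := by
  constructor
  · intro h
    have h1 := sq_sum q
    have e3 : q.1.imI = 0 := by nlinarith [sq_nonneg q.1.imI, sq_nonneg q.1.imJ, sq_nonneg q.1.imK]
    have e4 : q.1.imJ = 0 := by nlinarith [sq_nonneg q.1.imI, sq_nonneg q.1.imJ, sq_nonneg q.1.imK]
    have e5 : q.1.imK = 0 := by nlinarith [sq_nonneg q.1.imI, sq_nonneg q.1.imJ, sq_nonneg q.1.imK]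
    rcases _root_.sq_eq_one_iff.1 h with h | h
    · left; rw [ext_iff']; simp [*]
    · right; rw [ext_iff']; simp [*]
  · rintro (rfl | rfl) <;> simp

theorem eq_one_iff_re {q : UnitQuat} : q = 1 ↔ q.1.re = 1 := by
  constructor
  · rintro rfl; simp
  · intro h
    rcases re_sq_eq_one_iff.1 (by rw [h]; norm_num : q.1.re ^ 2 = 1) with h' | h'
    · exact h'
    · rw [h'] at h; norm_num at h

theorem eq_neg_one_iff_re {q : UnitQuat} : q = -1 ↔ q.1.re = -1 := by
  constructor
  · rintro rfl; simp
  · intro h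
    rcases re_sq_eq_one_iff.1 (by rw [h]; norm_num : q.1.re ^ 2 = 1) with h' | h'
    · rw [h'] at h; norm_num at h
    · exact h'

/-- A quaternion commuting with a non-real unit quaternion `h` has imaginary part proportional to
that of `h`. -/
theorem exists_im_eq_of_commute {h : UnitQuat} (h1 : h ≠ 1) (h2 : h ≠ -1) {y : ℍ[ℝ]}
    (hy : (h : ℍ[ℝ]) * y = y * h) :
    ∃ c : ℝ, y.imI = c * h.1.imI ∧ y.imJ = c * h.1.imJ ∧ y.imK = c * h.1.imK := by
  rw [Quaternion.ext_iff] at hy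
  simp only [Quaternion.imI_mul, Quaternion.imJ_mul, Quaternion.imK_mul] at hy
  obtain ⟨-, hi, hj, hk⟩ := hy
  have hs := sq_sum h
  set d := h.1.imI ^ 2 + h.1.imJ ^ 2 + h.1.imK ^ 2 with hd
  have hd0 : d ≠ 0 := by
    intro h0
    have : h.1.re ^ 2 = 1 := by linarith
    rcases re_sq_eq_one_iff.1 this with h | h <;> contradiction
  -- Commutation says that the cross product of the imaginary parts vanishes, so c is the
  -- coefficient of the orthogonal projection of Im y to Im h.
  refine ⟨(y.imI * h.1.imI + y.imJ * h.1.imJ + y.imK * h.1.imK) / d, ?_, ?_, ?_⟩ <;>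
    rw [div_mul_eq_mul_div, eq_div_iff hd0, hd]
  · linear_combination -(h.1.imJ * hk - h.1.imK * hj) / 2
  · linear_combination -(h.1.imK * hi - h.1.imI * hk) / 2
  · linear_combination -(h.1.imI * hj - h.1.imJ * hi) / 2

/-- The centralizer of a non-real quaternion v is the commutative plane ℝ + ℝ v. -/
theorem commute_of_commute {v h k : UnitQuat} (v1 : v ≠ 1) (v2 : v ≠ -1)
    (hh : v * h = h * v) (hk : v * k = k * v) : h * k = k * h := by
  obtain ⟨c, c1, c2, c3⟩ := exists_im_eq_of_commute v1 v2 (y := h) (congrArg Subtype.val hh)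
  obtain ⟨d, d1, d2, d3⟩ := exists_im_eq_of_commute v1 v2 (y := k) (congrArg Subtype.val hk)
  rw [ext_iff']
  simp only [Submonoid.coe_mul, Quaternion.re_mul, Quaternion.imI_mul, Quaternion.imJ_mul,
    Quaternion.imK_mul, c1, c2, c3, d1, d2, d3]
  refine ⟨?_, ?_, ?_, ?_⟩ <;> ring

/-- The set of unit imaginary quaternions commuting with a non-real `h` consists of two antipodal
points. -/
theorem exists_axis {h : UnitQuat} (h1 : h ≠ 1) (h2 : h ≠ -1) :
    ∃ u : UnitQuat, u * u = -1 ∧ h * u = u * h ∧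
      ∀ v : UnitQuat, v * v = -1 → h * v = v * h → v = u ∨ v = -u := by
  have hs := sq_sum h
  set d := h.1.imI ^ 2 + h.1.imJ ^ 2 + h.1.imK ^ 2 with hd
  have hd0 : 0 < d := by
    rcases (by positivity : 0 ≤ d).eq_or_lt with h0 | h0
    · have : h.1.re ^ 2 = 1 := by linarith
      rcases re_sq_eq_one_iff.1 this with h | h <;> contradiction
    · exact h0
  set s := Real.sqrt d with hsd
  have hs2 : s ^ 2 = d := Real.sq_sqrt hd0.le
  have hs0 : 0 < s := Real.sqrt_pos.2 hd0
  obtain ⟨u, u0, u1, u2, u3⟩ : ∃ u : ℍ[ℝ], u.re = 0 ∧ u.imI = h.1.imI / s ∧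
      u.imJ = h.1.imJ / s ∧ u.imK = h.1.imK / s :=
    ⟨⟨0, h.1.imI / s, h.1.imJ / s, h.1.imK / s⟩, rfl, rfl, rfl, rfl⟩
  have hu : u ∈ unitary ℍ[ℝ] := by
    apply mem_unitary_of_sq_sum
    rw [u0, u1, u2, u3]
    simp only [div_pow]
    field_simp
    rw [hs2, hd]; ring
  refine ⟨⟨u, hu⟩, mul_self_eq_neg_one_iff.2 u0, ?_, ?_⟩
  · rw [ext_iff']
    simp only [Submonoid.coe_mul, u0, u1, u2, u3, Quaternion.re_mul, Quaternion.imI_mul, Quaternion.imJ_mul,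
      Quaternion.imK_mul]
    refine ⟨?_, ?_, ?_, ?_⟩ <;> ring
  · intro v hv hhv
    have hvs := sq_sum v
    rw [mul_self_eq_neg_one_iff] at hv
    obtain ⟨c, c1, c2, c3⟩ := exists_im_eq_of_commute h1 h2 (y := v) (congrArg Subtype.val hhv)
    rw [hv, c1, c2, c3] at hvs
    have hcs : (c * s) ^ 2 = 1 := by rw [mul_pow, hs2, hd]; linear_combination hvs
    rcases _root_.sq_eq_one_iff.1 hcs with hc | hc
    · left
      rw [ext_iff', hv, c1, c2, c3]
      have : c = 1 / s := by field_simp; exact hc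
      subst this
      refine ⟨u0.symm, ?_, ?_, ?_⟩ <;> simp only [u1, u2, u3] <;> ring
    · right
      rw [ext_iff', hv, c1, c2, c3]
      have : c = -1 / s := by field_simp; exact hc
      subst this
      simp only [coe_neg, Quaternion.re_neg, Quaternion.imI_neg, Quaternion.imJ_neg,
        Quaternion.imK_neg, u0, u1, u2, u3, neg_zero, true_and]
      refine ⟨?_, ?_, ?_⟩ <;> ring

theorem ne_one_of_mul_self {v : UnitQuat} (hv : v * v = -1) : v ≠ 1 ∧ v ≠ -1 := by
  rw [mul_self_eq_neg_one_iff] at hv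
  constructor <;> rintro rfl <;> norm_num at hv

end UnitQuat

/-! ### Poles and the classification of finite groups of unit quaternions -/

namespace UnitQuat

/-- The elements of `H` commuting with `v`; for `v * v = -1` these are the elements of `H` whose
associated rotation fixes `v`. -/
noncomputable def axisStab (H : Subgroup UnitQuat) (v : UnitQuat) : Subgroup UnitQuat :=
  H ⊓ Subgroup.centralizer {v}

theorem mem_axisStab {H : Subgroup UnitQuat} {v h : UnitQuat} :
    h ∈ axisStab H v ↔ h ∈ H ∧ h * v = v * h := by
  rw [axisStab, Subgroup.mem_inf, Subgroup.mem_centralizer_singleton_iff]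

theorem axisStab_le (H : Subgroup UnitQuat) (v : UnitQuat) : axisStab H v ≤ H := inf_le_left

theorem axisStab_mono {H K : Subgroup UnitQuat} (h : H ≤ K) (v : UnitQuat) :
    axisStab H v ≤ axisStab K v := inf_le_inf_right _ h

/-- The poles of `H`: the unit imaginary quaternions fixed by a nontrivial rotation in `H`. -/
def poles (H : Subgroup UnitQuat) : Set UnitQuat :=
  {v | v * v = -1 ∧ ∃ h ∈ H, h ≠ 1 ∧ h ≠ -1 ∧ h * v = v * h}

theorem poles_mono {H K : Subgroup UnitQuat} (h : H ≤ K) : poles H ⊆ poles K :=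
  fun _ ⟨hv, k, hk, h'⟩ => ⟨hv, k, h hk, h'⟩

theorem conj_mul_self {g v : UnitQuat} (hv : v * v = -1) :
    g * v * g⁻¹ * (g * v * g⁻¹) = -1 := by
  have : g * v * g⁻¹ * (g * v * g⁻¹) = g * (v * v) * g⁻¹ := by group
  rw [this, hv]; simp

theorem conj_ne_one {g h : UnitQuat} (h1 : h ≠ 1) (h2 : h ≠ -1) :
    g * h * g⁻¹ ≠ 1 ∧ g * h * g⁻¹ ≠ -1 := by
  constructor
  · rwa [Ne, conj_eq_one_iff]
  · intro h3
    apply h2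
    have : h = g⁻¹ * (g * h * g⁻¹) * g := by group
    rw [this, h3]; simp

theorem conj_commute {g h v : UnitQuat} (hv : h * v = v * h) :
    g * h * g⁻¹ * (g * v * g⁻¹) = g * v * g⁻¹ * (g * h * g⁻¹) := by
  have e1 : g * h * g⁻¹ * (g * v * g⁻¹) = g * (h * v) * g⁻¹ := by group
  have e2 : g * v * g⁻¹ * (g * h * g⁻¹) = g * (v * h) * g⁻¹ := by group
  rw [e1, e2, hv]

theorem conj_mem_poles {H : Subgroup UnitQuat} {g v : UnitQuat} (hg : g ∈ H) (hv : v ∈ poles H) :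
    g * v * g⁻¹ ∈ poles H := by
  obtain ⟨hv, h, hh, h1, h2, h3⟩ := hv
  exact ⟨conj_mul_self hv, g * h * g⁻¹, H.mul_mem (H.mul_mem hg hh) (H.inv_mem hg),
    (conj_ne_one h1 h2).1, (conj_ne_one h1 h2).2, conj_commute h3⟩

noncomputable instance polesAction (H : Subgroup UnitQuat) : MulAction H (poles H) where
  smul g v := ⟨g * v * g⁻¹, conj_mem_poles g.2 v.2⟩
  one_smul v := Subtype.ext (show (1 : UnitQuat) * v * 1⁻¹ = v by group)
  mul_smul a b v := Subtype.ext (show ((a : UnitQuat) * b) * v * ((a : UnitQuat) * b)⁻¹ =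
    (a : UnitQuat) * (b * v * (b : UnitQuat)⁻¹) * (a : UnitQuat)⁻¹ by group)

theorem coe_smul_pole {H : Subgroup UnitQuat} (g : H) (v : poles H) :
    ((g • v : poles H) : UnitQuat) = g * v * (g : UnitQuat)⁻¹ := rfl

theorem smul_pole_eq_iff {H : Subgroup UnitQuat} (g : H) (v : poles H) :
    g • v = v ↔ (g : UnitQuat) * v = v * g := by
  rw [← Subtype.coe_inj, coe_smul_pole, mul_inv_eq_iff_eq_mul]

theorem finite_poles (H : Subgroup UnitQuat) [Finite H] : (poles H).Finite := by
  have : poles H ⊆ ⋃ h : H, {v | v * v = -1 ∧ (h : UnitQuat) ≠ 1 ∧ (h : UnitQuat) ≠ -1 ∧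
      (h : UnitQuat) * v = v * h} := by
    rintro v ⟨hv, h, hh, h'⟩
    exact Set.mem_iUnion.2 ⟨⟨h, hh⟩, hv, h'⟩
  refine (Set.finite_iUnion fun h => ?_).subset this
  by_cases hh : (h : UnitQuat) ≠ 1 ∧ (h : UnitQuat) ≠ -1
  · obtain ⟨u, -, -, hu⟩ := exists_axis hh.1 hh.2
    exact (Set.toFinite {u, -u}).subset fun v hv => hu v hv.1 hv.2.2.2
  · convert Set.finite_empty
    ext v
    simp only [Set.mem_ofPred_eq, Set.mem_empty_iff_false, iff_false]
    tauto

theorem orderOf_neg_one : orderOf (-1 : UnitQuat) = 2 :=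
  orderOf_eq_prime (by simp) (neg_ne 1)

theorem two_dvd_card {H : Subgroup UnitQuat} (h : -1 ∈ H) : 2 ∣ Nat.card H := by
  rw [← orderOf_neg_one]; exact Subgroup.orderOf_dvd_natCard H h

theorem neg_one_mem_axisStab {H : Subgroup UnitQuat} (h : -1 ∈ H) (v : UnitQuat) :
    -1 ∈ axisStab H v := mem_axisStab.2 ⟨h, by simp⟩

theorem two_lt_card_axisStab {H : Subgroup UnitQuat} [Finite H] (h : -1 ∈ H) {v : UnitQuat}
    (hv : v ∈ poles H) : 2 < Nat.card (axisStab H v) := by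
  obtain ⟨-, k, hk, k1, k2, hkv⟩ := hv
  have : Finite (axisStab H v) := Finite.of_injective _
    (Subgroup.inclusion_injective (axisStab_le H v))
  have h3 : ({1, -1, k} : Set UnitQuat) ⊆ axisStab H v := by
    rintro x (rfl | rfl | rfl)
    · exact one_mem _
    · exact neg_one_mem_axisStab h v
    · exact mem_axisStab.2 ⟨hk, hkv⟩
  have h4 := Set.ncard_le_ncard h3 (Set.toFinite _)
  rw [Set.ncard_insert_of_notMem, Set.ncard_pair k2.symm] at h4
  · exact h4
  · simp only [Set.mem_insert_iff, Set.mem_singleton_iff, not_or]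
    exact ⟨(neg_ne 1).symm, k1.symm⟩

theorem card_orbit_mul_card_axisStab (H : Subgroup UnitQuat) [Finite H] (v : poles H) :
    Nat.card (MulAction.orbit H v) * Nat.card (axisStab H v) = Nat.card H := by
  have h1 : Nat.card (axisStab H v) = Nat.card (MulAction.stabilizer H v) := by
    refine Nat.card_congr
      { toFun := fun x => ⟨⟨x, (mem_axisStab.1 x.2).1⟩,
          (smul_pole_eq_iff _ _).2 (mem_axisStab.1 x.2).2⟩
        invFun := fun x => ⟨x.1, mem_axisStab.2 ⟨x.1.2, (smul_pole_eq_iff _ _).1 x.2⟩⟩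
        left_inv := fun x => rfl
        right_inv := fun x => rfl }
  rw [h1, ← Nat.card_prod]
  exact Nat.card_congr (MulAction.orbitProdStabilizerEquivGroup H v)

theorem card_fixedBy {H : Subgroup UnitQuat} (h : H) (h1 : h ≠ 1) (h2 : (h : UnitQuat) ≠ -1) :
    Nat.card (MulAction.fixedBy (poles H) h) = 2 := by
  have h1' : (h : UnitQuat) ≠ 1 := fun h' => h1 (Subtype.ext h')
  obtain ⟨u, hu, hhu, huu⟩ := exists_axis h1' h2
  have hup : u ∈ poles H := ⟨hu, h, h.2, h1', h2, hhu⟩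
  have hnp : -u ∈ poles H := ⟨by simpa using hu, h, h.2, h1', h2, by simpa using hhu⟩
  have : MulAction.fixedBy (poles H) h = {⟨u, hup⟩, ⟨-u, hnp⟩} := by
    ext ⟨v, hv⟩
    rw [MulAction.mem_fixedBy, smul_pole_eq_iff]
    simp only [Set.mem_insert_iff, Set.mem_singleton_iff, Subtype.mk.injEq]
    constructor
    · exact huu v hv.1
    · rintro (rfl | rfl)
      · exact hhu
      · simpa using hhu
  rw [this, Nat.card_coe_set_eq, Set.ncard_pair]
  intro h'
  exact neg_ne u (Subtype.ext_iff.1 h').symm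

/-- Burnside's lemma for the action of a finite group of unit quaternions on its poles. -/
theorem burnside_poles (H : Subgroup UnitQuat) [Finite H] (hneg : -1 ∈ H) :
    2 * Nat.card (poles H) + 2 * (Nat.card H - 2) =
      Nat.card (MulAction.orbitRel.Quotient H (poles H)) * Nat.card H := by
  classical
  have := finite_poles H
  have : Finite (poles H) := this
  have := Fintype.ofFinite H
  have := Fintype.ofFinite (poles H)
  have := Fintype.ofFinite (MulAction.orbitRel.Quotient H (poles H))
  have hB := MulAction.sum_card_fixedBy_eq_card_orbits_mul_card_group H (poles H)
  simp only [← Nat.card_eq_fintype_card] at hB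
  have e : MulAction.orbitRel.Quotient H (poles H) =
    Quotient (MulAction.orbitRel H (poles H)) := rfl
  rw [e, ← hB]
  let n : H := ⟨-1, hneg⟩
  have hn : (1 : H) ≠ n := fun h => neg_ne 1 (Subtype.ext_iff.1 h).symm
  -- The elements ±1 fix every pole, and each of the remaining ones fixes exactly two.
  rw [← Finset.sum_add_sum_compl ({1, n} : Finset H), Finset.sum_pair hn]
  have h1 : MulAction.fixedBy (poles H) (1 : H) = Set.univ := by ext; simp
  have h2 : MulAction.fixedBy (poles H) n = Set.univ := by
    ext v
    rw [MulAction.mem_fixedBy, smul_pole_eq_iff]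
    simp [n]
  have h3 : ∑ h ∈ ({1, n} : Finset H)ᶜ, Nat.card (MulAction.fixedBy (poles H) h) =
      ∑ h ∈ ({1, n} : Finset H)ᶜ, 2 := by
    refine Finset.sum_congr rfl fun h hh => ?_
    simp only [Finset.mem_compl, Finset.mem_insert, Finset.mem_singleton, not_or] at hh
    exact card_fixedBy h hh.1 fun h' => hh.2 (Subtype.ext h')
  rw [h3, h1, h2, Finset.sum_const, Finset.card_compl, Finset.card_pair hn,
    ← Nat.card_eq_fintype_card, Nat.card_coe_set_eq Set.univ, Set.ncard_univ]
  ring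

theorem card_poles_eq_sum (H : Subgroup UnitQuat) [Finite H]
    [Fintype (MulAction.orbitRel.Quotient H (poles H))] :
    Nat.card (poles H) = ∑ ω : MulAction.orbitRel.Quotient H (poles H),
      Nat.card (MulAction.orbit H ω.out) := by
  have : Finite (poles H) := finite_poles H
  rw [Nat.card_congr (MulAction.selfEquivSigmaOrbits H (poles H)), Nat.card_sigma]

/-- A finite group of unit quaternions of icosahedral type: its order is `120`, its pole
stabilizers have order `4`, `6` or `10`, and `10` occurs. -/
structure IsIcosahedral (H : Subgroup UnitQuat) : Prop where
  neg_one_mem : -1 ∈ H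
  card_eq : Nat.card H = 120
  card_axisStab : ∀ v ∈ poles H, Nat.card (axisStab H v) = 4 ∨ Nat.card (axisStab H v) = 6 ∨
    Nat.card (axisStab H v) = 10
  exists_ten : ∃ v ∈ poles H, Nat.card (axisStab H v) = 10

/-- Here n is the order of the rotation group, the kᵢ are the sizes of the three orbits of poles and
the aᵢ the orders of their stabilizers. The equation is 1/a₁ + 1/a₂ + 1/a₃ = 1 + 2/n, so a₁ = 2 and
a₂ ≤ 3. The value a₂ = 2 is the dihedral case k₃ = 2; for a₂ = 3, the values a₃ = 3, 4, 5 give n =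
12, 24, 60. -/
theorem orbit_sizes {n a₁ a₂ a₃ k₁ k₂ k₃ : ℕ} (h₁ : a₁ * k₁ = n) (h₂ : a₂ * k₂ = n)
    (h₃ : a₃ * k₃ = n) (ha₁ : 2 ≤ a₁) (ha₂ : 2 ≤ a₂) (ha₃ : 2 ≤ a₃) (h : k₁ + k₂ + k₃ = n + 2)
    (h₁₂ : k₂ ≤ k₁) (h₂₃ : k₃ ≤ k₂) :
    k₃ ≤ 2 ∨ n = 12 ∨ n = 24 ∨ n = 60 ∧ a₁ = 2 ∧ a₂ = 3 ∧ a₃ = 5 := by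
  have b₁ : a₁ < 3 := by
    by_contra! hc
    have := Nat.mul_le_mul_right k₁ hc
    omega
  obtain rfl : a₁ = 2 := by omega
  have b₂ : a₂ < 4 := by
    by_contra! hc
    have := Nat.mul_le_mul_right k₂ hc
    omega
  have b₃ : a₂ = 2 ∨ a₂ = 3 := by omega
  rcases b₃ with rfl | rfl
  · omega
  · have b₄ : a₃ < 6 := by
      by_contra! hc
      have := Nat.mul_le_mul_right k₃ hc
      omega
    interval_cases a₃ <;> omega

theorem orbit_sizes' {n a₁ a₂ a₃ k₁ k₂ k₃ : ℕ} (h₁ : a₁ * k₁ = n) (h₂ : a₂ * k₂ = n)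
    (h₃ : a₃ * k₃ = n) (ha₁ : 2 ≤ a₁) (ha₂ : 2 ≤ a₂) (ha₃ : 2 ≤ a₃) (h : k₁ + k₂ + k₃ = n + 2) :
    (k₁ ≤ 2 ∨ k₂ ≤ 2 ∨ k₃ ≤ 2) ∨ n = 12 ∨ n = 24 ∨ n = 60 ∧ (a₁ = 5 ∨ a₂ = 5 ∨ a₃ = 5) ∧
      (a₁ = 2 ∨ a₁ = 3 ∨ a₁ = 5) ∧ (a₂ = 2 ∨ a₂ = 3 ∨ a₂ = 5) ∧ (a₃ = 2 ∨ a₃ = 3 ∨ a₃ = 5) := by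
  rcases le_total k₁ k₂ with h12 | h12 <;> rcases le_total k₂ k₃ with h23 | h23 <;>
    rcases le_total k₁ k₃ with h13 | h13
  · have := orbit_sizes h₃ h₂ h₁ ha₃ ha₂ ha₁ (by omega) h23 h12
    omega
  · have := orbit_sizes h₃ h₂ h₁ ha₃ ha₂ ha₁ (by omega) h23 h12
    omega
  · have := orbit_sizes h₂ h₃ h₁ ha₂ ha₃ ha₁ (by omega) h23 h13
    omega
  · have := orbit_sizes h₂ h₁ h₃ ha₂ ha₁ ha₃ (by omega) h12 h13
    omega
  · have := orbit_sizes h₃ h₁ h₂ ha₃ ha₁ ha₂ (by omega) h13 h12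
    omega
  · have := orbit_sizes h₁ h₃ h₂ ha₁ ha₃ ha₂ (by omega) h13 h23
    omega
  · have := orbit_sizes h₁ h₂ h₃ ha₁ ha₂ ha₃ (by omega) h12 h23
    omega
  · have := orbit_sizes h₁ h₂ h₃ ha₁ ha₂ ha₃ (by omega) h12 h23
    omega

theorem exists_mul_self_eq_neg_one : ∃ v : UnitQuat, v * v = -1 := by
  have h : (⟨0, 1, 0, 0⟩ : ℍ[ℝ]) ∈ unitary ℍ[ℝ] := mem_unitary_of_sq_sum (by norm_num)
  exact ⟨⟨_, h⟩, mul_self_eq_neg_one_iff.2 rfl⟩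

/-- A finite group of unit quaternions containing `-1` has an abelian subgroup of index at most
two, or order `24` or `48`, or it is of icosahedral type. -/
theorem classification (H : Subgroup UnitQuat) [Finite H] (hneg : -1 ∈ H) :
    (∃ v : UnitQuat, v * v = -1 ∧ Nat.card H ≤ 2 * Nat.card (axisStab H v)) ∨
      Nat.card H = 24 ∨ Nat.card H = 48 ∨ IsIcosahedral H := by
  classical
  have : Finite (poles H) := finite_poles H
  have := Fintype.ofFinite (MulAction.orbitRel.Quotient H (poles H))
  have hB := burnside_poles H hneg
  rw [card_poles_eq_sum, Nat.card_eq_fintype_card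
    (α := MulAction.orbitRel.Quotient H (poles H))] at hB
  by_contra! hcon
  obtain ⟨hab, h24, h48, hico⟩ := hcon
  obtain ⟨n, hn⟩ := two_dvd_card hneg
  have hpos : 0 < Nat.card H := Nat.card_pos
  -- The halves n of |H| and a of the stabilizer order count rotations, since ±1 act alike. An orbit
  -- of at most two poles would put H in the first alternative.
  have key : ∀ v : poles H, ∃ a, 2 ≤ a ∧ Nat.card (axisStab H v) = 2 * a ∧
      a * Nat.card (MulAction.orbit H v) = n ∧ 2 < Nat.card (MulAction.orbit H v) := by
    intro v
    obtain ⟨a, ha⟩ := two_dvd_card (neg_one_mem_axisStab hneg v)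
    have h2 := two_lt_card_axisStab hneg v.2
    have h3 := card_orbit_mul_card_axisStab H v
    refine ⟨a, by omega, ha, ?_, ?_⟩
    · rw [ha, hn] at h3
      have : 2 * (a * Nat.card (MulAction.orbit H v)) = 2 * n := by rw [← h3]; ring
      omega
    · have h4 := hab v v.2.1
      rw [← h3] at h4
      exact lt_of_mul_lt_mul_right h4 (Nat.zero_le _)
  have hn1 : n ≠ 1 := by
    rintro rfl
    obtain ⟨v, hv⟩ := exists_mul_self_eq_neg_one
    have h1 := hab v hv
    have h2 := Nat.le_of_dvd (by
      have := Finite.of_injective _ (Subgroup.inclusion_injective (axisStab_le H v))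
      exact Nat.card_pos) (two_dvd_card (neg_one_mem_axisStab hneg v))
    omega
  have hub : 2 * ∑ ω : MulAction.orbitRel.Quotient H (poles H), Nat.card (MulAction.orbit H ω.out) ≤ Fintype.card (MulAction.orbitRel.Quotient H (poles H)) * n := by
    rw [Finset.mul_sum, ← smul_eq_mul, ← Finset.card_univ, ← Finset.sum_const]
    refine Finset.sum_le_sum fun ω _ => ?_
    obtain ⟨a, ha, -, h, -⟩ := key ω.out
    rw [← h]
    exact Nat.mul_le_mul_right _ ha
  have hlb : 3 * Fintype.card (MulAction.orbitRel.Quotient H (poles H)) ≤ ∑ ω : MulAction.orbitRel.Quotient H (poles H), Nat.card (MulAction.orbit H ω.out) := by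
    rw [mul_comm, ← smul_eq_mul, ← Finset.card_univ, ← Finset.sum_const]
    refine Finset.sum_le_sum fun ω _ => ?_
    obtain ⟨a, -, -, -, h⟩ := key ω.out
    exact h
  -- For m orbits, Burnside's lemma says that the orbit sizes add up to (m - 2) n + 2. Each size is
  -- at most n / 2, which gives m < 4; each is at least 3, which together with n ≠ 1 excludes m ≤ 2.
  have hm : Fintype.card (MulAction.orbitRel.Quotient H (poles H)) = 3 := by
    rw [hn] at hB
    have h1 : Fintype.card (MulAction.orbitRel.Quotient H (poles H)) < 4 := by
      by_contra! hc
      have := Nat.mul_le_mul_right n hc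
      have h2 : Fintype.card (MulAction.orbitRel.Quotient H (poles H)) * (2 * n) = 2 * (Fintype.card (MulAction.orbitRel.Quotient H (poles H)) * n) := by ring
      omega
    have h2 : Fintype.card (MulAction.orbitRel.Quotient H (poles H)) * (2 * n) = 2 * (Fintype.card (MulAction.orbitRel.Quotient H (poles H)) * n) := by ring
    interval_cases h : Fintype.card (MulAction.orbitRel.Quotient H (poles H)) <;> omega
  have e : Fin 3 ≃ MulAction.orbitRel.Quotient H (poles H) := (Fintype.equivFinOfCardEq hm).symm
  have hsum : ∑ ω : MulAction.orbitRel.Quotient H (poles H), Nat.card (MulAction.orbit H ω.out) =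
      ∑ i : Fin 3, Nat.card (MulAction.orbit H (e i).out) := (Equiv.sum_comp e _).symm
  rw [hm, hsum, Fin.sum_univ_three] at hB
  obtain ⟨a₁, ha₁, hs₁, hk₁, hl₁⟩ := key (e 0).out
  obtain ⟨a₂, ha₂, hs₂, hk₂, hl₂⟩ := key (e 1).out
  obtain ⟨a₃, ha₃, hs₃, hk₃, hl₃⟩ := key (e 2).out
  rcases orbit_sizes' hk₁ hk₂ hk₃ ha₁ ha₂ ha₃ (by omega) with h | h | h | ⟨h, h5, h1, h2, h3⟩
  · omega
  · omega
  · omega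
  · apply hico
    have hall : ∀ i, Nat.card (axisStab H (e i).out) = 4 ∨ Nat.card (axisStab H (e i).out) = 6 ∨
        Nat.card (axisStab H (e i).out) = 10 := by
      intro i
      fin_cases i
      · change Nat.card (axisStab H (e 0).out) = 4 ∨ Nat.card (axisStab H (e 0).out) = 6 ∨
          Nat.card (axisStab H (e 0).out) = 10
        omega
      · change Nat.card (axisStab H (e 1).out) = 4 ∨ Nat.card (axisStab H (e 1).out) = 6 ∨
          Nat.card (axisStab H (e 1).out) = 10
        omega
      · change Nat.card (axisStab H (e 2).out) = 4 ∨ Nat.card (axisStab H (e 2).out) = 6 ∨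
          Nat.card (axisStab H (e 2).out) = 10
        omega
    refine ⟨hneg, by omega, ?_, ?_⟩
    · intro v hv
      let ω : MulAction.orbitRel.Quotient H (poles H) := Quotient.mk'' ⟨v, hv⟩
      have h1 : (⟨v, hv⟩ : poles H) ∈ MulAction.orbit H ω.out := by
        have : Quotient.mk'' ω.out = ω := Quotient.out_eq' ω
        exact (MulAction.orbitRel_apply.1 (Quotient.exact' this.symm))
      have h2 := card_orbit_mul_card_axisStab H ⟨v, hv⟩
      rw [MulAction.orbit_eq_iff.2 h1, ← card_orbit_mul_card_axisStab H ω.out] at h2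
      obtain ⟨-, -, -, -, hl⟩ := key ω.out
      have h3 : Nat.card (axisStab H v) = Nat.card (axisStab H ω.out) :=
        Nat.eq_of_mul_eq_mul_left (by omega) h2
      have h4 := hall (e.symm ω)
      rw [Equiv.apply_symm_apply] at h4
      rw [h3]; exact h4
    · rcases h5 with rfl | rfl | rfl
      · exact ⟨_, (e 0).out.2, hs₁⟩
      · exact ⟨_, (e 1).out.2, hs₂⟩
      · exact ⟨_, (e 2).out.2, hs₃⟩

end UnitQuat

/-! ### Solvable cases and normal subgroups of icosahedral groups -/

theorem Group.isSolvable_of_natCard_le_three {A : Type*} [Group A] [Finite A]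
    (h : Nat.card A ≤ 3) : Group.IsSolvable A := by
  have hpos : 0 < Nat.card A := Nat.card_pos
  have key : ∀ p : ℕ, p.Prime → Nat.card A = p → Group.IsSolvable A := by
    intro p hp hA
    have := Fact.mk hp
    have := isCyclic_of_prime_card hA
    exact Group.isSolvable_of_comm fun a b => IsCyclic.isMulCommutative.is_comm.comm a b
  have h3 : Nat.card A = 1 ∨ Nat.card A = 2 ∨ Nat.card A = 3 := by omega
  rcases h3 with h1 | h2 | h3
  · have := (Nat.card_eq_one_iff_unique.1 h1).1
    infer_instance
  · exact key 2 Nat.prime_two h2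
  · exact key 3 Nat.prime_three h3

namespace UnitQuat

theorem finite_axisStab (H : Subgroup UnitQuat) [Finite H] (v : UnitQuat) :
    Finite (axisStab H v) :=
  Finite.of_injective _ (Subgroup.inclusion_injective (axisStab_le H v))

/-- The stabilizer of an axis is abelian, being in the centralizer of a non-real quaternion, and
here its index is at most two. -/
theorem isSolvable_of_card_le_two_mul {H : Subgroup UnitQuat} [Finite H] {v : UnitQuat}
    (hv : v * v = -1) (h : Nat.card H ≤ 2 * Nat.card (axisStab H v)) : Group.IsSolvable H := by
  have := finite_axisStab H v
  set A := (axisStab H v).subgroupOf H with hA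
  have hcard : Nat.card A = Nat.card (axisStab H v) :=
    Nat.card_congr (Subgroup.subgroupOfEquivOfLe (axisStab_le H v)).toEquiv
  have hi := A.card_mul_index
  have hpos : 0 < Nat.card (axisStab H v) := Nat.card_pos
  have hi2 : A.index ≤ 2 := by
    rw [hcard] at hi
    rw [← hi, mul_comm] at h
    exact le_of_mul_le_mul_right h hpos
  have hi0 : A.index ≠ 0 := Subgroup.FiniteIndex.index_ne_zero
  have hn : A.Normal := by
    have : A.index = 1 ∨ A.index = 2 := by omega
    rcases this with h | h
    · rw [Subgroup.index_eq_one.1 h]; infer_instance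
    · exact Subgroup.normal_of_index_eq_two h
  have hvne := ne_one_of_mul_self hv
  have hs : Group.IsSolvable A := Group.isSolvable_of_comm fun a b => by
    have ha := mem_axisStab.1 (Subgroup.mem_subgroupOf.1 a.2)
    have hb := mem_axisStab.1 (Subgroup.mem_subgroupOf.1 b.2)
    exact Subtype.ext (Subtype.ext (commute_of_commute hvne.1 hvne.2 ha.2.symm hb.2.symm))
  have hq : Group.IsSolvable (H ⧸ A) := Group.isSolvable_of_natCard_le_three (by
    rw [← Subgroup.index_eq_card]; omega)
  exact Group.isSolvable_of_ker_le_range A.subtype (QuotientGroup.mk' A) (by simp)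

theorem pow_card_axisStab {H : Subgroup UnitQuat} {v h : UnitQuat} (hh : h ∈ axisStab H v) :
    h ^ Nat.card (axisStab H v) = 1 :=
  orderOf_dvd_iff_pow_eq_one.1 (Subgroup.orderOf_dvd_natCard _ hh)

theorem mem_poles_of_axis {H : Subgroup UnitQuat} {h u : UnitQuat} (hh : h ∈ H) (h1 : h ≠ 1)
    (h2 : h ≠ -1) (hu : u * u = -1) (hhu : h * u = u * h) : u ∈ poles H :=
  ⟨hu, h, hh, h1, h2, hhu⟩

/-- An element other than ±1 lies in the stabilizer of its own axis, of order 4, 6 or 10, and the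
only square roots of 1 are ±1. -/
theorem IsIcosahedral.pow_eq {H : Subgroup UnitQuat} (hH : IsIcosahedral H) {h : UnitQuat}
    (hh : h ∈ H) : h ^ 2 = 1 ∨ h ^ 2 = -1 ∨ h ^ 3 = 1 ∨ h ^ 3 = -1 ∨ h ^ 5 = 1 ∨ h ^ 5 = -1 := by
  by_cases h1 : h = 1
  · simp [h1]
  by_cases h2 : h = -1
  · simp [h2]
  obtain ⟨u, hu, hhu, -⟩ := exists_axis h1 h2
  have hp := pow_card_axisStab (mem_axisStab.2 ⟨hh, hhu⟩)
  rcases hH.card_axisStab u (mem_poles_of_axis hh h1 h2 hu hhu) with hc | hc | hc <;> rw [hc] at hp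
  · have : h ^ 2 * h ^ 2 = 1 := by rw [← pow_add]; exact hp
    rcases sq_eq_one_iff.1 this with h | h <;> simp [h]
  · have : h ^ 3 * h ^ 3 = 1 := by rw [← pow_add]; exact hp
    rcases sq_eq_one_iff.1 this with h | h <;> simp [h]
  · have : h ^ 5 * h ^ 5 = 1 := by rw [← pow_add]; exact hp
    rcases sq_eq_one_iff.1 this with h | h <;> simp [h]

theorem IsIcosahedral.finite {H : Subgroup UnitQuat} (hH : IsIcosahedral H) : Finite H :=
  Nat.finite_of_card_ne_zero (by rw [hH.card_eq]; norm_num)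

theorem axisStab_card_conj {H : Subgroup UnitQuat} [Finite H] {g u : UnitQuat} (hg : g ∈ H)
    (hu : u ∈ poles H) : Nat.card (axisStab H (g * u * g⁻¹)) = Nat.card (axisStab H u) := by
  have h1 := card_orbit_mul_card_axisStab H ⟨u, hu⟩
  have h2 := card_orbit_mul_card_axisStab H ((⟨g, hg⟩ : H) • (⟨u, hu⟩ : poles H))
  rw [MulAction.orbit_smul, ← h1] at h2
  refine Nat.eq_of_mul_eq_mul_left ?_ h2
  by_contra! h0
  have : 0 < Nat.card H := Nat.card_pos
  simp only [nonpos_iff_eq_zero] at h0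
  rw [h0, zero_mul] at h1
  omega

/-- A subgroup of an icosahedral group that contains `-1` and another nontrivial element and is
stable under conjugation has index at most three. -/
theorem IsIcosahedral.le_card_of_normal {H K : Subgroup UnitQuat} (hH : IsIcosahedral H)
    (hKH : K ≤ H) (hneg : -1 ∈ K) (hconj : ∀ h ∈ H, ∀ k ∈ K, h * k * h⁻¹ ∈ K) {k₀ : UnitQuat}
    (hk₀ : k₀ ∈ K) (h1 : k₀ ≠ 1) (h2 : k₀ ≠ -1) : 32 ≤ Nat.card K := by
  classical
  have := hH.finite
  have : Finite K := Finite.of_injective _ (Subgroup.inclusion_injective hKH)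
  have : Finite (poles H) := finite_poles H
  obtain ⟨u, hu, hku, -⟩ := exists_axis h1 h2
  have huK : u ∈ poles K := mem_poles_of_axis hk₀ h1 h2 hu hku
  have huH : u ∈ poles H := poles_mono hKH huK
  have := Fintype.ofFinite (MulAction.orbit H (⟨u, huH⟩ : poles H))
  have := Fintype.ofFinite K
  set O := (MulAction.orbit H (⟨u, huH⟩ : poles H)).toFinset with hO
  set n : K := ⟨-1, hneg⟩ with hn
  have hn1 : (1 : K) ≠ n := fun h => neg_ne 1 (Subtype.ext_iff.1 h).symm
  set T : Finset K := {1, n}ᶜ with hT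
  have hTc : T.card = Nat.card K - 2 := by
    rw [hT, Finset.card_compl, Finset.card_pair hn1, Nat.card_eq_fintype_card]
  have hOc : O.card * Nat.card (axisStab H u) = 120 := by
    have := card_orbit_mul_card_axisStab H ⟨u, huH⟩
    rwa [hH.card_eq, Nat.card_eq_fintype_card (α := MulAction.orbit H _), ← Set.toFinset_card] at this
  -- Double count of the pairs (pole w in the orbit of u, element k ≠ ±1 of K fixing w). With s the
  -- order of the stabilizer of u, this gives (120 / s)(s - 2) ≤ 2 (|K| - 2). The weakest bound, |K|
  -- ≥ 32, comes from s = 4.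
  have hle := Finset.card_mul_le_card_mul (s := O) (t := T)
    (fun (w : poles H) (k : K) => (k : UnitQuat) * w = w * k)
    (m := Nat.card (axisStab H u) - 2) (n := 2) ?_ ?_
  · rw [hTc] at hle
    rcases hH.card_axisStab u huH with h | h | h <;> rw [h] at hle hOc <;> omega
  · intro w hw
    obtain ⟨g, rfl⟩ : ∃ g : H, g • (⟨u, huH⟩ : poles H) = w := by
      rw [hO, Set.mem_toFinset] at hw; exact hw
    set w : UnitQuat := g * u * (g : UnitQuat)⁻¹ with hw'
    have hwK : w ∈ poles K := by
      obtain ⟨hu, k, hk, k1, k2, hku⟩ := huK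
      exact ⟨conj_mul_self hu, g * k * (g : UnitQuat)⁻¹, hconj g g.2 k hk, (conj_ne_one k1 k2).1,
        (conj_ne_one k1 k2).2, conj_commute hku⟩
    have e1 : Nat.card (axisStab H w) = Nat.card (axisStab H u) := axisStab_card_conj g.2 huH
    have e2 : Nat.card (axisStab K w) ∣ Nat.card (axisStab H w) :=
      Subgroup.card_dvd_of_le (axisStab_mono hKH w)
    have e3 := two_lt_card_axisStab hneg hwK
    have e4 := two_dvd_card (neg_one_mem_axisStab hneg w)
    -- The stabilizer in K has even order greater than 2 dividing 4, 6 or 10. These are twice a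
    -- prime, so it is the whole stabilizer in H.
    have e5 : Nat.card (axisStab K w) = Nat.card (axisStab H u) := by
      rw [← e1]
      obtain ⟨c, hc⟩ := e4
      rw [hc] at e2 e3 ⊢
      rcases hH.card_axisStab w (poles_mono hKH hwK) with h | h | h <;> rw [h] at e2 ⊢
      · have := Nat.le_of_dvd (by norm_num) e2
        omega
      · have := Nat.le_of_dvd (by norm_num) e2
        have : c = 2 ∨ c = 3 := by omega
        rcases this with rfl | rfl <;> omega
      · have := Nat.le_of_dvd (by norm_num) e2
        have : c = 2 ∨ c = 3 ∨ c = 4 ∨ c = 5 := by omega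
        rcases this with rfl | rfl | rfl | rfl <;> omega
    have hB : T.bipartiteAbove (fun (w : poles H) (k : K) => (k : UnitQuat) * w = w * k)
        (g • (⟨u, huH⟩ : poles H)) =
        (Finset.univ.filter fun k : K => (k : UnitQuat) * w = w * k) \ {1, n} := by
      ext k
      simp only [Finset.bipartiteAbove, Finset.mem_filter, Finset.mem_sdiff, hT,
        Finset.mem_compl, Finset.mem_univ, true_and, coe_smul_pole]
      tauto
    have hC : (Finset.univ.filter fun k : K => (k : UnitQuat) * w = w * k).card =
        Nat.card (axisStab K w) := by
      rw [← Fintype.card_subtype, ← Nat.card_eq_fintype_card]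
      exact Nat.card_congr
        { toFun := fun x => ⟨x.1, mem_axisStab.2 ⟨x.1.2, x.2⟩⟩
          invFun := fun x => ⟨⟨x, (mem_axisStab.1 x.2).1⟩, (mem_axisStab.1 x.2).2⟩
          left_inv := fun x => rfl
          right_inv := fun x => rfl }
    rw [hB, ← e5, ← hC, ← Finset.card_pair hn1]
    exact Finset.le_card_sdiff _ _
  · intro k hk
    have hk' : (k : UnitQuat) ≠ 1 ∧ (k : UnitQuat) ≠ -1 := by
      simp only [hT, Finset.mem_compl, Finset.mem_insert, Finset.mem_singleton, not_or] at hk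
      exact ⟨fun h => hk.1 (Subtype.ext h), fun h => hk.2 (Subtype.ext h)⟩
    obtain ⟨x, -, -, hx⟩ := exists_axis hk'.1 hk'.2
    rw [← Finset.card_map (Function.Embedding.subtype _)]
    refine (Finset.card_le_card (t := {x, -x}) ?_).trans Finset.card_le_two
    intro w hw
    simp only [Finset.mem_map, Finset.bipartiteBelow, Finset.mem_filter] at hw
    obtain ⟨w, ⟨-, hw⟩, rfl⟩ := hw
    have := hx w w.2.1 hw
    simpa using this

/-- The index of K is at most three, because 4 · 32 > 120. -/
theorem IsIcosahedral.isSolvable_quotient {H : Subgroup UnitQuat} (hH : IsIcosahedral H)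
    (K : Subgroup H) [K.Normal] (hneg : (⟨-1, hH.neg_one_mem⟩ : H) ∈ K) {k₀ : H} (hk₀ : k₀ ∈ K)
    (h1 : (k₀ : UnitQuat) ≠ 1) (h2 : (k₀ : UnitQuat) ≠ -1) : Group.IsSolvable (H ⧸ K) := by
  have := hH.finite
  have h := hH.le_card_of_normal (K := K.map H.subtype) (Subgroup.map_subtype_le K)
    ⟨_, hneg, rfl⟩ (by
      rintro h hh _ ⟨k, hk, rfl⟩
      exact ⟨_, Subgroup.Normal.conj_mem ‹_› k hk ⟨h, hh⟩, rfl⟩) ⟨k₀, hk₀, rfl⟩ h1 h2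
  rw [Subgroup.card_map_of_injective H.subtype_injective] at h
  have hi := K.card_mul_index
  rw [hH.card_eq] at hi
  refine Group.isSolvable_of_natCard_le_three ?_
  rw [← Subgroup.index_eq_card]
  by_contra! hc
  have := Nat.mul_le_mul h hc
  omega

end UnitQuat

/-! ### Traces of elements of an icosahedral group -/

namespace UnitQuat

/-- The number 2 Re h is the trace of h in SU(2); traces of powers are Chebyshev-type polynomials in
it. -/
theorem re_pow_three (h : UnitQuat) : 2 * (h ^ 3).1.re = (2 * h.1.re) ^ 3 - 3 * (2 * h.1.re) := by
  have hs := sq_sum h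
  simp only [pow_succ, pow_zero, one_mul, Submonoid.coe_mul, Quaternion.re_mul,
    Quaternion.imI_mul, Quaternion.imJ_mul, Quaternion.imK_mul]
  linear_combination -6 * h.1.re * hs

theorem re_pow_two (h : UnitQuat) : 2 * (h ^ 2).1.re = (2 * h.1.re) ^ 2 - 2 := by
  have hs := sq_sum h
  simp only [pow_succ, pow_zero, one_mul, Submonoid.coe_mul, Quaternion.re_mul]
  linear_combination -2 * hs

theorem re_mul_add_re_mul_inv (h k : UnitQuat) :
    (h * k).1.re + (h * k⁻¹).1.re = 2 * h.1.re * k.1.re := by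
  simp only [Submonoid.coe_mul, coe_inv, Quaternion.re_mul, Quaternion.re_star,
    Quaternion.imI_star, Quaternion.imJ_star, Quaternion.imK_star]
  ring

theorem re_inv (h : UnitQuat) : (h⁻¹).1.re = h.1.re := by simp

theorem re_pow_five (h : UnitQuat) :
    2 * (h ^ 5).1.re = (2 * h.1.re) ^ 5 - 5 * (2 * h.1.re) ^ 3 + 5 * (2 * h.1.re) := by
  have h1 := re_mul_add_re_mul_inv (h ^ 3) (h ^ 2)
  have e1 : h ^ 3 * h ^ 2 = h ^ 5 := by group
  have e2 : h ^ 3 * (h ^ 2)⁻¹ = h := by group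
  rw [e1, e2] at h1
  have h2 := re_pow_two h
  have h3 := re_pow_three h
  linear_combination 2 * h1 + 2 * (h ^ 3).1.re * h2 + ((2 * h.1.re) ^ 2 - 2) * h3

open Real in
theorem re_of_pow_five {h : UnitQuat} (hh : h ^ 5 = 1) (h1 : h ≠ 1) :
    2 * h.1.re = goldenRatio - 1 ∨ 2 * h.1.re = -goldenRatio := by
  have h5 := re_pow_five h
  have hφ := goldenRatio_sq
  rw [hh] at h5
  set t := 2 * h.1.re with ht
  -- This is the factorization t⁵ - 5t³ + 5t - 2 = (t - 2)(t² + t - 1)²; the quadratic has the roots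
  -- φ - 1 and -φ.
  have : (t - 2) * ((t - (goldenRatio - 1)) * (t + goldenRatio)) ^ 2 = 0 := by
    have e : (t - (goldenRatio - 1)) * (t + goldenRatio) = t ^ 2 + t - 1 := by
      linear_combination -hφ
    rw [e]
    simp only [OneMemClass.coe_one, Quaternion.re_one] at h5
    linear_combination -h5
  rcases mul_eq_zero.1 this with h' | h'
  · exact absurd (eq_one_iff_re.2 (by linarith)) h1
  · rcases mul_eq_zero.1 (pow_eq_zero_iff two_ne_zero |>.1 h') with h' | h'
    · left; linarith
    · right; linarith

theorem pow_five_neg {h : UnitQuat} (hh : h ^ 5 = -1) : (-h) ^ 5 = 1 := by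
  rw [Odd.neg_pow (by decide), hh, neg_neg]

open Real in
-- The nine values are 2 cos θ for θ a multiple of π/2, π/3 or π/5, the angles that `pow_eq`
-- permits.
theorem IsIcosahedral.two_re {H : Subgroup UnitQuat} (hH : IsIcosahedral H) {h : UnitQuat}
    (hh : h ∈ H) : 2 * h.1.re = 2 ∨ 2 * h.1.re = -2 ∨ 2 * h.1.re = 0 ∨ 2 * h.1.re = 1 ∨
      2 * h.1.re = -1 ∨ 2 * h.1.re = goldenRatio ∨ 2 * h.1.re = -goldenRatio ∨
      2 * h.1.re = goldenRatio - 1 ∨ 2 * h.1.re = 1 - goldenRatio := by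
  have e1 : ((1 : UnitQuat) : ℍ[ℝ]).re = 1 := rfl
  have e2 : ((-1 : UnitQuat) : ℍ[ℝ]).re = -1 := by simp
  rcases hH.pow_eq hh with h' | h' | h' | h' | h' | h'
  · have h2 := re_pow_two h
    rw [h', e1] at h2
    have : (2 * h.1.re - 2) * (2 * h.1.re + 2) = 0 := by linear_combination -h2
    rcases mul_eq_zero.1 this with h | h
    · left; linarith
    · right; left; linarith
  · have h2 := re_pow_two h
    rw [h', e2] at h2
    have : (2 * h.1.re) ^ 2 = 0 := by linear_combination -h2
    have := pow_eq_zero_iff two_ne_zero |>.1 this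
    simp [this]
  · have h2 := re_pow_three h
    rw [h', e1] at h2
    have : (2 * h.1.re - 2) * (2 * h.1.re + 1) ^ 2 = 0 := by linear_combination -h2
    rcases mul_eq_zero.1 this with h | h
    · left; linarith
    · have := pow_eq_zero_iff two_ne_zero |>.1 h
      right; right; right; right; left; linarith
  · have h2 := re_pow_three h
    rw [h', e2] at h2
    have : (2 * h.1.re + 2) * (2 * h.1.re - 1) ^ 2 = 0 := by linear_combination -h2
    rcases mul_eq_zero.1 this with h | h
    · right; left; linarith
    · have := pow_eq_zero_iff two_ne_zero |>.1 h
      right; right; right; left; linarith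
  · by_cases h1 : h = 1
    · left; rw [h1, e1]; norm_num
    · rcases re_of_pow_five h' h1 with h | h <;> simp only [h, true_or, or_true]
  · by_cases h1 : -h = 1
    · right; left
      have : h = -1 := by rw [← h1, neg_neg]
      rw [this, e2]; norm_num
    · have h3 := re_of_pow_five (pow_five_neg h') h1
      rw [coe_neg, Quaternion.re_neg] at h3
      rcases h3 with h | h
      · right; right; right; right; right; right; right; right; linarith
      · right; right; right; right; right; left; linarith

open Real in
theorem goldenRatio_bounds : 1.6 < goldenRatio ∧ goldenRatio < 1.7 := by
  have hφ := goldenRatio_sq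
  have h1 := one_lt_goldenRatio
  constructor <;> nlinarith

open Real in
/-- Two elements of order ten with angle `π / 5` in an icosahedral group are equal, inverse, or
their axes include one of the two angles between adjacent axes of an icosahedron. -/
theorem IsIcosahedral.re_mul_cases {H : Subgroup UnitQuat} (hH : IsIcosahedral H)
    {h k : UnitQuat} (hh : h ∈ H) (hk : k ∈ H) (h2 : 2 * h.1.re = goldenRatio)
    (k2 : 2 * k.1.re = goldenRatio) : h * k = 1 ∨ h * k⁻¹ = 1 ∨
      (2 * (h * k).1.re = 1 ∧ 2 * (h * k⁻¹).1.re = goldenRatio) ∨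
      (2 * (h * k).1.re = goldenRatio ∧ 2 * (h * k⁻¹).1.re = 1) := by
  have hφ := goldenRatio_sq
  obtain ⟨b1, b2⟩ := goldenRatio_bounds
  have hs : 2 * (h * k).1.re + 2 * (h * k⁻¹).1.re = goldenRatio + 1 := by
    linear_combination 2 * re_mul_add_re_mul_inv h k + goldenRatio * k2 + 2 * k.1.re * h2 + hφ
  have hx := hH.two_re (H.mul_mem hh hk)
  have hy := hH.two_re (H.mul_mem hh (H.inv_mem hk))
  rw [eq_one_iff_re, eq_one_iff_re]
  set x := 2 * (h * k).1.re
  set y := 2 * (h * k⁻¹).1.re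
  -- Both traces belong to the list of nine values and their sum is φ + 1 = φ². The only
  -- decompositions are 2 + (φ - 1) and 1 + φ, and the numerical bounds on φ exclude the others.
  have key : x = 2 ∨ y = 2 ∨ (x = 1 ∧ y = goldenRatio) ∨ (x = goldenRatio ∧ y = 1) := by
    rcases hx with hx | hx | hx | hx | hx | hx | hx | hx | hx
    · exact Or.inl hx
    all_goals
      rcases hy with hy | hy | hy | hy | hy | hy | hy | hy | hy
      · exact Or.inr (Or.inl hy)
      all_goals first
        | exact Or.inr (Or.inr (Or.inl ⟨hx, hy⟩))
        | exact Or.inr (Or.inr (Or.inr ⟨hx, hy⟩))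
        | exfalso; linarith
  rcases key with h | h | h | h
  · left; linarith
  · right; left; linarith
  · exact Or.inr (Or.inr (Or.inl h))
  · exact Or.inr (Or.inr (Or.inr h))

end UnitQuat

/-! ### Simultaneous conjugation of unit quaternions -/

namespace UnitQuat

theorem exists_smul_eq {x : ℍ[ℝ]} (hx : x ≠ 0) : ∃ (c : UnitQuat) (s : ℝ), (c : ℍ[ℝ]) = s • x := by
  have hd : 0 < x.re ^ 2 + x.imI ^ 2 + x.imJ ^ 2 + x.imK ^ 2 := by
    rcases (by positivity : 0 ≤ x.re ^ 2 + x.imI ^ 2 + x.imJ ^ 2 + x.imK ^ 2).eq_or_lt with h | h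
    · exfalso
      apply hx
      have h0 : x.re = 0 := by nlinarith [sq_nonneg x.imI, sq_nonneg x.imJ, sq_nonneg x.imK]
      have h1 : x.imI = 0 := by nlinarith [sq_nonneg x.re, sq_nonneg x.imJ, sq_nonneg x.imK]
      have h2 : x.imJ = 0 := by nlinarith [sq_nonneg x.re, sq_nonneg x.imI, sq_nonneg x.imK]
      have h3 : x.imK = 0 := by nlinarith [sq_nonneg x.re, sq_nonneg x.imI, sq_nonneg x.imJ]
      rw [Quaternion.ext_iff]
      exact ⟨h0, h1, h2, h3⟩
    · exact h
  set d := x.re ^ 2 + x.imI ^ 2 + x.imJ ^ 2 + x.imK ^ 2 with hdd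
  have hs : (Real.sqrt d)⁻¹ ^ 2 * d = 1 := by
    rw [inv_pow, Real.sq_sqrt hd.le, inv_mul_cancel₀ hd.ne']
  refine ⟨⟨(Real.sqrt d)⁻¹ • x, mem_unitary_of_sq_sum ?_⟩, _, rfl⟩
  simp only [Quaternion.re_smul, Quaternion.imI_smul, Quaternion.imJ_smul, Quaternion.imK_smul,
    smul_eq_mul]
  linear_combination hs - (Real.sqrt d)⁻¹ ^ 2 * hdd

theorem conj_eq_of_smul {c h h' : UnitQuat} {s : ℝ} {x : ℍ[ℝ]} (hc : (c : ℍ[ℝ]) = s • x)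
    (hx : x * h = h' * x) : c * h * c⁻¹ = h' := by
  rw [mul_inv_eq_iff_eq_mul]
  apply Subtype.ext
  rw [Submonoid.coe_mul, Submonoid.coe_mul, hc, smul_mul_assoc, hx, mul_smul_comm]

/-- Unit quaternions with the same real part are conjugate. -/
theorem exists_intertwiner {h h' : UnitQuat} (hre : h.1.re = h'.1.re) :
    ∃ x : ℍ[ℝ], x ≠ 0 ∧ x * h = h' * x := by
  have h1 := sq_sum h
  have h2 := sq_sum h'
  rw [← hre] at h2
  -- Every x = h' y - y h̄ intertwines h and h', because both satisfy the same quadratic equation q²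
  -- = 2 Re(h) q - 1.
  have key : ∀ y : ℍ[ℝ], (h' * y - y * star (h : ℍ[ℝ])) * h = h' * (h' * y - y * star (h : ℍ[ℝ])) := by
    intro y
    have e1 : star (h : ℍ[ℝ]) * h = 1 := Unitary.coe_star_mul_self h
    have e2 : star (h : ℍ[ℝ]) = ((2 * h.1.re : ℝ) : ℍ[ℝ]) - h := by
      ext <;> simp
      ring
    have e3 := mul_self_eq h'
    rw [← hre] at e3
    rw [sub_mul, mul_assoc y, e1, mul_sub, ← mul_assoc (h' : ℍ[ℝ]) h', e3, e2]
    have e4 : y * ((2 * h.1.re : ℝ) : ℍ[ℝ]) = ((2 * h.1.re : ℝ) : ℍ[ℝ]) * y :=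
      (Quaternion.coe_commutes _ _).symm
    have e5 : (h' : ℍ[ℝ]) * ((2 * h.1.re : ℝ) : ℍ[ℝ]) = ((2 * h.1.re : ℝ) : ℍ[ℝ]) * h' :=
      (Quaternion.coe_commutes _ _).symm
    rw [mul_sub y, e4, mul_sub, ← mul_assoc (h' : ℍ[ℝ]) _ y, e5]
    noncomm_ring
  -- If all these x vanish, then y = 1 gives h' = h̄ and this element is central, hence real; so h =
  -- h' and x = 1 intertwines after all.
  by_contra! hcon
  have hz : ∀ y : ℍ[ℝ], h' * y - y * star (h : ℍ[ℝ]) = 0 := by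
    intro y
    by_contra hy
    exact hcon _ hy (key y)
  have hz1 := hz 1
  rw [mul_one, one_mul, sub_eq_zero] at hz1
  have hcomm : ∀ y : ℍ[ℝ], star (h : ℍ[ℝ]) * y = y * star (h : ℍ[ℝ]) := by
    intro y
    have := hz y
    rwa [hz1, sub_eq_zero] at this
  obtain ⟨i, i0, i1, i2, i3⟩ : ∃ i : ℍ[ℝ], i.re = 0 ∧ i.imI = 1 ∧ i.imJ = 0 ∧ i.imK = 0 :=
    ⟨⟨0, 1, 0, 0⟩, rfl, rfl, rfl, rfl⟩
  obtain ⟨j, j0, j1, j2, j3⟩ : ∃ i : ℍ[ℝ], i.re = 0 ∧ i.imI = 0 ∧ i.imJ = 1 ∧ i.imK = 0 :=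
    ⟨⟨0, 0, 1, 0⟩, rfl, rfl, rfl, rfl⟩
  have hi := hcomm i
  have hj := hcomm j
  rw [Quaternion.ext_iff] at hi hj
  simp only [Quaternion.imI_mul, Quaternion.imJ_mul, Quaternion.imK_mul, Quaternion.re_star,
    Quaternion.imI_star, Quaternion.imJ_star, Quaternion.imK_star, i0, i1, i2, i3, j0, j1, j2, j3] at hi hj
  obtain ⟨-, -, hi2, hi3⟩ := hi
  obtain ⟨-, hj1, -, hj3⟩ := hj
  ring_nf at hi2 hi3 hj1 hj3
  have a1 : h.1.imI = 0 := by linarith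
  have a2 : h.1.imJ = 0 := by linarith
  have a3 : h.1.imK = 0 := by linarith
  refine hcon 1 one_ne_zero ?_
  rw [one_mul, mul_one, hz1]
  ext <;> simp [a1, a2, a3]

theorem exists_conj_eq {h h' : UnitQuat} (hre : h.1.re = h'.1.re) :
    ∃ c : UnitQuat, c * h * c⁻¹ = h' := by
  obtain ⟨x, hx, hxh⟩ := exists_intertwiner hre
  obtain ⟨c, s, hc⟩ := exists_smul_eq hx
  exact ⟨c, conj_eq_of_smul hc hxh⟩

/-- Conjugation by the centralizer of `h` is transitive on the `k` with prescribed angles. -/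
theorem exists_conj_fixing {h k k' : UnitQuat} (hre : k.1.re = k'.1.re)
    (hmul : (h * k).1.re = (h * k').1.re) (hk : h * k ≠ k * h) :
    ∃ c : UnitQuat, c * h * c⁻¹ = h ∧ c * k * c⁻¹ = k' := by
  have hs := sq_sum h
  have hks := sq_sum k
  have hks' := sq_sum k'
  simp only [Submonoid.coe_mul, Quaternion.re_mul] at hmul
  -- The commutators n = [h, k] and n' = [h, k'] are twice the cross products of u = Im h with Im k
  -- and Im k'. They are orthogonal to u and, by the hypotheses on real parts, of equal length. It
  -- suffices that x commute with u and carry n to n', since u, n and the inner product b determine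
  -- Im k.
  obtain ⟨u, hu⟩ : ∃ u : ℍ[ℝ], u = ((h : ℍ[ℝ]).im : ℍ[ℝ]) := ⟨_, rfl⟩
  obtain ⟨n, hn⟩ : ∃ n : ℍ[ℝ], n = (h : ℍ[ℝ]) * k - k * h := ⟨_, rfl⟩
  obtain ⟨n', hn'⟩ : ∃ n' : ℍ[ℝ], n' = (h : ℍ[ℝ]) * k' - k' * h := ⟨_, rfl⟩
  have hn0 : n ≠ 0 := by
    rw [hn, sub_ne_zero]
    intro h'
    exact hk (Subtype.ext h')
  obtain ⟨a, ha⟩ : ∃ a : ℝ, a = h.1.imI ^ 2 + h.1.imJ ^ 2 + h.1.imK ^ 2 := ⟨_, rfl⟩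
  obtain ⟨b, hb⟩ : ∃ b : ℝ, b = h.1.imI * k.1.imI + h.1.imJ * k.1.imJ + h.1.imK * k.1.imK := ⟨_, rfl⟩
  have hb' : b = h.1.imI * k'.1.imI + h.1.imJ * k'.1.imJ + h.1.imK * k'.1.imK := by
    rw [hb]; rw [hre] at hmul; linear_combination -hmul
  obtain ⟨d, hd⟩ : ∃ d : ℝ, d = k.1.imI ^ 2 + k.1.imJ ^ 2 + k.1.imK ^ 2 := ⟨_, rfl⟩
  have hd' : d = k'.1.imI ^ 2 + k'.1.imJ ^ 2 + k'.1.imK ^ 2 := by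
    rw [hd]; rw [hre] at hks; linear_combination hks - hks'
  have anti : ∀ w : ℍ[ℝ], ((h : ℍ[ℝ]) * w - w * h) * u = -(u * ((h : ℍ[ℝ]) * w - w * h)) := by
    intro w
    rw [hu]
    ext <;> simp <;> ring
  have e1 : n * u = -(u * n) := by rw [hn]; exact anti _
  have e1' : n' * u = -(u * n') := by rw [hn']; exact anti _
  obtain ⟨N, hN⟩ : ∃ N : ℝ, N = -(4 * (a * d - b ^ 2)) := ⟨_, rfl⟩
  have e2 : n * n = (N : ℍ[ℝ]) := by
    rw [hn]
    ext <;> simp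
    · rw [hN, ha, hb, hd]; ring
    all_goals ring
  have e2' : n' * n' = (N : ℍ[ℝ]) := by
    rw [hn']
    ext <;> simp
    · rw [hN, ha, hb', hd']; ring
    all_goals ring
  have e3 : (2 * a) • ((k : ℍ[ℝ]).im : ℍ[ℝ]) = (2 * b) • u - u * n := by
    rw [hn, ha, hb, hu]
    ext <;> simp <;> ring
  have e3' : (2 * a) • ((k' : ℍ[ℝ]).im : ℍ[ℝ]) = (2 * b) • u - u * n' := by
    rw [hn', ha, hb', hu]
    ext <;> simp <;> ring
  have ha0 : 2 * a ≠ 0 := by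
    intro h0
    have : h.1.re ^ 2 = 1 := by linarith
    rcases re_sq_eq_one_iff.1 this with h | h <;> simp [h] at hk
  have hdec : ∀ q : ℍ[ℝ], q = (q.re : ℍ[ℝ]) + (q.im : ℍ[ℝ]) := fun q => (Quaternion.re_add_im q).symm
  have main : ∀ x : ℍ[ℝ], x * u = u * x → x * n = n' * x → x * h = h * x ∧ x * k = k' * x := by
    intro x hxu hxn
    constructor
    · rw [hdec (h : ℍ[ℝ]), ← hu, mul_add, add_mul, hxu, Quaternion.coe_commutes]
    · have h1 : x * ((2 * a) • ((k : ℍ[ℝ]).im : ℍ[ℝ])) = ((2 * a) • ((k' : ℍ[ℝ]).im : ℍ[ℝ])) * x := by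
        rw [e3, e3', mul_sub, sub_mul, mul_smul_comm, smul_mul_assoc, hxu, ← mul_assoc, hxu,
          mul_assoc, hxn, mul_assoc]
      rw [mul_smul_comm, smul_mul_assoc] at h1
      have h2 := smul_right_injective ℍ[ℝ] ha0 h1
      rw [hdec (k : ℍ[ℝ]), hdec (k' : ℍ[ℝ]), mul_add, add_mul, h2, hre, Quaternion.coe_commutes]
  have fin : ∀ x : ℍ[ℝ], x ≠ 0 → x * u = u * x → x * n = n' * x →
      ∃ c : UnitQuat, c * h * c⁻¹ = h ∧ c * k * c⁻¹ = k' := by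
    intro x hx h1 h2
    obtain ⟨c, s, hc⟩ := exists_smul_eq hx
    obtain ⟨h3, h4⟩ := main x h1 h2
    exact ⟨c, conj_eq_of_smul hc h3, conj_eq_of_smul hc h4⟩
  -- The element n' n + n² commutes with u and carries n to n' because n² = n'² is real. It vanishes
  -- only for n' = -n, and then u itself serves, since u anticommutes with n.
  by_cases hx : n' * n + n * n = 0
  · rw [← add_mul] at hx
    have hnn : n' = -n := by
      rcases mul_eq_zero.1 hx with h | h
      · exact eq_neg_of_add_eq_zero_left h
      · exact absurd h hn0
    refine fin u ?_ rfl ?_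
    · intro hu0
      rw [hu0, zero_mul, smul_zero, sub_zero] at e3
      have h4 : ((k : ℍ[ℝ]).im : ℍ[ℝ]) = 0 := (smul_eq_zero.1 e3).resolve_left ha0
      apply hn0
      rw [hn, hdec (k : ℍ[ℝ]), h4, add_zero, Quaternion.coe_commutes, sub_self]
    · rw [hnn, neg_mul, e1, neg_neg]
  · refine fin _ hx ?_ ?_
    · rw [add_mul, mul_add, mul_assoc n', e1, mul_neg, ← mul_assoc n', e1', neg_mul, neg_neg,
        mul_assoc n n, e1, mul_neg, ← mul_assoc n, e1, neg_mul, neg_neg, mul_assoc, mul_assoc]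
    · have h5 : n * n * n = n' * n' * n := by rw [e2, e2']
      rw [add_mul, mul_add, h5, ← mul_assoc n' n' n, mul_assoc n' n n, add_comm]

end UnitQuat

/-! ### Rotors about the vertices of the icosahedron -/

namespace UnitQuat

open Real in
/-- The unit quaternion `(φ + (φ - 1) x) / 2`; for `x = (a, b, c)` a vertex of the icosahedron it
acts as the rotation by `2π / 5` about `x`. -/
noncomputable def vertexRotor (a b c : ℝ) : ℍ[ℝ] :=
  ⟨goldenRatio / 2, (goldenRatio - 1) / 2 * a, (goldenRatio - 1) / 2 * b,
    (goldenRatio - 1) / 2 * c⟩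

section
open Real

variable (a b c : ℝ)
@[simp] theorem re_vertexRotor : (vertexRotor a b c).re = goldenRatio / 2 := rfl
@[simp] theorem imI_vertexRotor : (vertexRotor a b c).imI = (goldenRatio - 1) / 2 * a := rfl
@[simp] theorem imJ_vertexRotor : (vertexRotor a b c).imJ = (goldenRatio - 1) / 2 * b := rfl
@[simp] theorem imK_vertexRotor : (vertexRotor a b c).imK = (goldenRatio - 1) / 2 * c := rfl

theorem star_vertexRotor : star (vertexRotor a b c) = vertexRotor (-a) (-b) (-c) := by
  ext <;> simp

theorem vertexRotor_mem {a b c : ℝ} (h : a ^ 2 + b ^ 2 + c ^ 2 = goldenRatio + 2) :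
    vertexRotor a b c ∈ unitary ℍ[ℝ] := by
  have hφ := goldenRatio_sq
  apply mem_unitary_of_sq_sum
  simp only [re_vertexRotor, imI_vertexRotor, imJ_vertexRotor, imK_vertexRotor]
  linear_combination (goldenRatio - 1) ^ 2 / 4 * h + (goldenRatio + 2) / 4 * hφ

theorem icosahedronVertices_subset : icosahedronVertices ⊆
    (fun s : Fin 3 × ℝ × ℝ => match s.1 with
      | 0 => ⟨0, 0, s.2.1, s.2.2⟩
      | 1 => ⟨0, s.2.1, s.2.2, 0⟩
      | 2 => ⟨0, s.2.2, 0, s.2.1⟩) ''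
      (Set.univ ×ˢ ({1, -1} ×ˢ {goldenRatio, -goldenRatio})) := by
  rintro v ⟨s, t, hs, ht, rfl | rfl | rfl⟩
  · exact ⟨(0, s, t), ⟨trivial, hs, ht⟩, rfl⟩
  · exact ⟨(1, s, t), ⟨trivial, hs, ht⟩, rfl⟩
  · exact ⟨(2, s, t), ⟨trivial, hs, ht⟩, rfl⟩

theorem finite_icosahedronVertices : icosahedronVertices.Finite :=
  (((Set.finite_univ).prod ((Set.toFinite _).prod (Set.toFinite _))).image _).subset
    icosahedronVertices_subset

theorem vertexRotor_eq {v : ℍ[ℝ]} (hv : v.re = 0) : vertexRotor v.imI v.imJ v.imK =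
    ((goldenRatio / 2 : ℝ) : ℍ[ℝ]) + ((goldenRatio - 1) / 2) • v := by
  ext <;> simp only [re_vertexRotor, imI_vertexRotor, imJ_vertexRotor, imK_vertexRotor,
    Quaternion.re_add, Quaternion.imI_add, Quaternion.imJ_add, Quaternion.imK_add,
    Quaternion.re_coe, Quaternion.imI_coe, Quaternion.imJ_coe, Quaternion.imK_coe,
    Quaternion.re_smul, Quaternion.imI_smul, Quaternion.imJ_smul, Quaternion.imK_smul, hv,
    smul_eq_mul, mul_zero, add_zero, zero_add]

theorem re_mul_vertexRotor {h k : UnitQuat} {a b c x y z : ℝ}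
    (hh : (h : ℍ[ℝ]) = vertexRotor a b c) (hk : (k : ℍ[ℝ]) = vertexRotor x y z) :
    4 * (h * k).1.re = goldenRatio + 1 - (2 - goldenRatio) * (a * x + b * y + c * z) := by
  have hφ := goldenRatio_sq
  simp only [Submonoid.coe_mul, hh, hk, Quaternion.re_mul, re_vertexRotor, imI_vertexRotor,
    imJ_vertexRotor, imK_vertexRotor]
  linear_combination (1 - (a * x + b * y + c * z)) * hφ

/-- An element with angle `π / 5` of an icosahedral group containing the rotor of a vertex is that
rotor, its inverse, or its axis makes the standard angle with the vertex. -/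
theorem IsIcosahedral.inner_vertex {H : Subgroup UnitQuat} (hH : IsIcosahedral H) {h k : UnitQuat}
    (hh : h ∈ H) (hk : k ∈ H) {a b c x y z : ℝ} (eh : (h : ℍ[ℝ]) = vertexRotor a b c)
    (ek : (k : ℍ[ℝ]) = vertexRotor x y z) : h = k ∨ h = k⁻¹ ∨
      a * x + b * y + c * z = goldenRatio ∨ a * x + b * y + c * z = -goldenRatio := by
  have hφ := goldenRatio_sq
  have h2 : 2 * h.1.re = goldenRatio := by rw [eh, re_vertexRotor]; ring
  have k2 : 2 * k.1.re = goldenRatio := by rw [ek, re_vertexRotor]; ring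
  have h3 := re_mul_vertexRotor eh ek
  -- The coefficient 2 - φ of the inner product is φ⁻², so multiplying by φ + 1 isolates that inner
  -- product.
  have h4 : (2 - goldenRatio) * (goldenRatio + 1) = 1 := by linear_combination -hφ
  rcases hH.re_mul_cases hh hk h2 k2 with h | h | ⟨h, -⟩ | ⟨h, -⟩
  · right; left; exact eq_inv_of_mul_eq_one_left h
  · left; exact mul_inv_eq_one.1 h
  · right; right; left
    linear_combination (goldenRatio + 1) * h3 - 2 * (goldenRatio + 1) * h + hφ -
      (a * x + b * y + c * z) * h4
  · right; right; right
    linear_combination (goldenRatio + 1) * h3 - 2 * (goldenRatio + 1) * h - hφ -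
      (a * x + b * y + c * z) * h4

/-- The rotors `h` in `H` whose axes are the vertices of the standard icosahedron. -/
def HasRotor (H : Subgroup UnitQuat) (a b c : ℝ) : Prop :=
  ∃ h ∈ H, (h : ℍ[ℝ]) = vertexRotor a b c

theorem HasRotor.conj {H : Subgroup UnitQuat} {r : UnitQuat} (hr : r ∈ H) {a b c x y z : ℝ}
    (h : HasRotor H a b c)
    (hmul : (r : ℍ[ℝ]) * vertexRotor a b c = vertexRotor x y z * r) : HasRotor H x y z := by
  obtain ⟨g, hg, eg⟩ := h
  refine ⟨r * g * r⁻¹, H.mul_mem (H.mul_mem hr hg) (H.inv_mem hr), ?_⟩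
  rw [Submonoid.coe_mul, Submonoid.coe_mul, eg, hmul, mul_assoc, ← Submonoid.coe_mul,
    mul_inv_cancel, OneMemClass.coe_one, mul_one]

theorem HasRotor.neg {H : Subgroup UnitQuat} {a b c : ℝ} (h : HasRotor H a b c) :
    HasRotor H (-a) (-b) (-c) := by
  obtain ⟨g, hg, eg⟩ := h
  exact ⟨g⁻¹, H.inv_mem hg, by rw [coe_inv, eg, star_vertexRotor]⟩

/-- This identity and the next three say that the rotor of (0, 1, φ) turns its five neighbours
cyclically: (0, -1, φ), (φ, 0, 1), (1, φ, 0), (-1, φ, 0), (-φ, 0, 1). With (0, 1, φ) and the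
antipodes these are all twelve vertices. -/
theorem vertexRotor_conj_one : vertexRotor 0 1 goldenRatio * vertexRotor 0 (-1) goldenRatio =
    vertexRotor goldenRatio 0 1 * vertexRotor 0 1 goldenRatio := by
  have hφ := goldenRatio_sq
  ext <;> simp only [Quaternion.re_mul, Quaternion.imI_mul, Quaternion.imJ_mul, Quaternion.imK_mul,
    re_vertexRotor, imI_vertexRotor, imJ_vertexRotor, imK_vertexRotor] <;>
  generalize goldenRatio = p at * <;> grind

theorem vertexRotor_conj_two : vertexRotor 0 1 goldenRatio * vertexRotor goldenRatio 0 1 =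
    vertexRotor 1 goldenRatio 0 * vertexRotor 0 1 goldenRatio := by
  have hφ := goldenRatio_sq
  ext <;> simp only [Quaternion.re_mul, Quaternion.imI_mul, Quaternion.imJ_mul, Quaternion.imK_mul,
    re_vertexRotor, imI_vertexRotor, imJ_vertexRotor, imK_vertexRotor] <;>
  generalize goldenRatio = p at * <;> grind

theorem vertexRotor_conj_three : vertexRotor 0 1 goldenRatio * vertexRotor 1 goldenRatio 0 =
    vertexRotor (-1) goldenRatio 0 * vertexRotor 0 1 goldenRatio := by
  have hφ := goldenRatio_sq
  ext <;> simp only [Quaternion.re_mul, Quaternion.imI_mul, Quaternion.imJ_mul, Quaternion.imK_mul,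
    re_vertexRotor, imI_vertexRotor, imJ_vertexRotor, imK_vertexRotor] <;>
  generalize goldenRatio = p at * <;> grind

theorem vertexRotor_conj_four : vertexRotor 0 1 goldenRatio * vertexRotor (-1) goldenRatio 0 =
    vertexRotor (-goldenRatio) 0 1 * vertexRotor 0 1 goldenRatio := by
  have hφ := goldenRatio_sq
  ext <;> simp only [Quaternion.re_mul, Quaternion.imI_mul, Quaternion.imJ_mul, Quaternion.imK_mul,
    re_vertexRotor, imI_vertexRotor, imJ_vertexRotor, imK_vertexRotor] <;>
  generalize goldenRatio = p at * <;> grind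

/-- A group containing the rotors of two adjacent vertices contains the rotors of all vertices. -/
theorem hasRotor_of_mem {H : Subgroup UnitQuat} (h0 : HasRotor H 0 1 goldenRatio)
    (h1 : HasRotor H 0 (-1) goldenRatio) {v : ℍ[ℝ]} (hv : v ∈ icosahedronVertices) :
    v.re = 0 ∧ HasRotor H v.imI v.imJ v.imK := by
  obtain ⟨r, hr, er⟩ := id h0
  have h2 : HasRotor H goldenRatio 0 1 := h1.conj hr (by rw [er]; exact vertexRotor_conj_one)
  have h3 : HasRotor H 1 goldenRatio 0 := h2.conj hr (by rw [er]; exact vertexRotor_conj_two)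
  have h4 : HasRotor H (-1) goldenRatio 0 := h3.conj hr (by rw [er]; exact vertexRotor_conj_three)
  have h5 : HasRotor H (-goldenRatio) 0 1 := h4.conj hr (by rw [er]; exact vertexRotor_conj_four)
  obtain ⟨s, t, rfl | rfl, rfl | rfl, rfl | rfl | rfl⟩ := hv
  · exact ⟨rfl, h0⟩
  · exact ⟨rfl, h3⟩
  · exact ⟨rfl, h2⟩
  · exact ⟨rfl, by simpa using h1.neg⟩
  · exact ⟨rfl, by simpa using h4.neg⟩
  · exact ⟨rfl, h5⟩
  · exact ⟨rfl, h1⟩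
  · exact ⟨rfl, h4⟩
  · exact ⟨rfl, by simpa using h5.neg⟩
  · exact ⟨rfl, by simpa using h0.neg⟩
  · exact ⟨rfl, by simpa using h3.neg⟩
  · exact ⟨rfl, by simpa using h2.neg⟩

/-- The conditions are inner products with the vertices (0, ±1, φ) and (±1, φ, 0). The first pair
leaves b ∈ {0, ±φ} and the second b ∈ {0, ±1}, so b = 0, and a and c follow. -/
theorem coords_of_inner {a b c : ℝ}
    (h1 : b + goldenRatio * c = goldenRatio ∨ b + goldenRatio * c = -goldenRatio)
    (h2 : -b + goldenRatio * c = goldenRatio ∨ -b + goldenRatio * c = -goldenRatio)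
    (h3 : a + goldenRatio * b = goldenRatio ∨ a + goldenRatio * b = -goldenRatio)
    (h4 : -a + goldenRatio * b = goldenRatio ∨ -a + goldenRatio * b = -goldenRatio) :
    (a = goldenRatio ∨ a = -goldenRatio) ∧ b = 0 ∧ (c = 1 ∨ c = -1) := by
  obtain ⟨p1, p2⟩ := goldenRatio_bounds
  have hp : goldenRatio ≠ 0 := by positivity
  have hb1 : b = 0 ∨ b = goldenRatio ∨ b = -goldenRatio := by
    rcases h1 with h1 | h1 <;> rcases h2 with h2 | h2
    · left; linarith
    · right; left; linarith
    · right; right; linarith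
    · left; linarith
  have hb2 : b = 0 ∨ goldenRatio * b = goldenRatio * 1 ∨ goldenRatio * b = goldenRatio * (-1) := by
    rcases h3 with h3 | h3 <;> rcases h4 with h4 | h4
    · right; left; linarith
    · left; have : goldenRatio * b = 0 := by linarith
      exact (mul_eq_zero.1 this).resolve_left hp
    · left; have : goldenRatio * b = 0 := by linarith
      exact (mul_eq_zero.1 this).resolve_left hp
    · right; right; linarith
  have hb : b = 0 := by
    rcases hb2 with h | h | h
    · exact h
    · have := mul_left_cancel₀ hp h
      rcases hb1 with h | h | h <;> linarith
    · have := mul_left_cancel₀ hp h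
      rcases hb1 with h | h | h <;> linarith
  subst hb
  refine ⟨?_, rfl, ?_⟩
  · rcases h3 with h | h
    · left; linarith
    · right; linarith
  · rcases h1 with h | h
    · left; exact mul_left_cancel₀ hp (by linarith)
    · right; exact mul_left_cancel₀ hp (by linarith)

theorem neg_mem_icosahedronVertices {v : ℍ[ℝ]} (hv : v ∈ icosahedronVertices) :
    -v ∈ icosahedronVertices := by
  obtain ⟨s, t, hs, ht, h⟩ := hv
  refine ⟨-s, -t, ?_, ?_, ?_⟩
  · rcases hs with rfl | rfl <;> simp
  · rcases ht with rfl | rfl <;> simp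
  · rcases h with rfl | rfl | rfl
    · left; exact Quaternion.ext _ _ neg_zero neg_zero rfl rfl
    · right; left; exact Quaternion.ext _ _ neg_zero rfl rfl neg_zero
    · right; right; exact Quaternion.ext _ _ neg_zero rfl neg_zero rfl

/-- If v were not a vertex, its inner product with every vertex would be ±φ by `inner_vertex`. Four
of these conditions already make v equal to some (±φ, 0, ±1), which is a vertex. -/
theorem IsIcosahedral.mem_vertices {H : Subgroup UnitQuat} (hH : IsIcosahedral H)
    (h0 : HasRotor H 0 1 goldenRatio) (h1 : HasRotor H 0 (-1) goldenRatio) {h : UnitQuat}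
    (hh : h ∈ H) {v : ℍ[ℝ]} (hv0 : v.re = 0) (hv : (h : ℍ[ℝ]) = vertexRotor v.imI v.imJ v.imK) :
    v ∈ icosahedronVertices := by
  have hp : (goldenRatio - 1) / 2 ≠ 0 := by
    obtain ⟨p1, p2⟩ := goldenRatio_bounds
    intro h; linarith
  have inj : ∀ w : ℍ[ℝ], w.re = 0 → vertexRotor v.imI v.imJ v.imK = vertexRotor w.imI w.imJ w.imK →
      v = w := by
    intro w hw he
    rw [vertexRotor_eq hv0, vertexRotor_eq hw] at he
    exact smul_right_injective ℍ[ℝ] hp (add_left_cancel he)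
  have key : ∀ w ∈ icosahedronVertices, v ∈ icosahedronVertices ∨
      v.imI * w.imI + v.imJ * w.imJ + v.imK * w.imK = goldenRatio ∨
      v.imI * w.imI + v.imJ * w.imJ + v.imK * w.imK = -goldenRatio := by
    intro w hw
    obtain ⟨hw0, k, hk, ek⟩ := hasRotor_of_mem h0 h1 hw
    rcases hH.inner_vertex hh hk hv ek with h | h | h
    · left
      rw [inj w hw0 (by rw [← hv, ← ek, h])]
      exact hw
    · left
      rw [inj (-w) (by simpa using hw0) (by
        rw [← hv, h, coe_inv, ek, star_vertexRotor]; simp)]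
      exact neg_mem_icosahedronVertices hw
    · exact Or.inr h
  by_contra hcon
  have k1 := (key ⟨0, 0, 1, goldenRatio⟩
    ⟨1, goldenRatio, Or.inl rfl, Or.inl rfl, Or.inl rfl⟩).resolve_left hcon
  have k2 := (key ⟨0, 0, -1, goldenRatio⟩
    ⟨-1, goldenRatio, Or.inr rfl, Or.inl rfl, Or.inl rfl⟩).resolve_left hcon
  have k3 := (key ⟨0, 1, goldenRatio, 0⟩
    ⟨1, goldenRatio, Or.inl rfl, Or.inl rfl, Or.inr (Or.inl rfl)⟩).resolve_left hcon
  have k4 := (key ⟨0, -1, goldenRatio, 0⟩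
    ⟨-1, goldenRatio, Or.inr rfl, Or.inl rfl, Or.inr (Or.inl rfl)⟩).resolve_left hcon
  obtain ⟨ha, hb, hc⟩ := coords_of_inner (a := v.imI) (b := v.imJ) (c := v.imK)
    (by convert k1 using 2 <;> ring) (by convert k2 using 2 <;> ring)
    (by convert k3 using 2 <;> ring) (by convert k4 using 2 <;> ring)
  refine hcon ⟨v.imK, v.imI, hc, ha, Or.inr (Or.inr ?_)⟩
  exact Quaternion.ext _ _ hv0 rfl hb rfl

theorem conj_vertexRotor {g h : UnitQuat} {v : ℍ[ℝ]} (hv0 : v.re = 0)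
    (hv : (h : ℍ[ℝ]) = vertexRotor v.imI v.imJ v.imK) :
    ((g : ℍ[ℝ]) * v * star (g : ℍ[ℝ])).re = 0 ∧ ((g * h * g⁻¹ : UnitQuat) : ℍ[ℝ]) =
      vertexRotor ((g : ℍ[ℝ]) * v * star (g : ℍ[ℝ])).imI ((g : ℍ[ℝ]) * v * star (g : ℍ[ℝ])).imJ
        ((g : ℍ[ℝ]) * v * star (g : ℍ[ℝ])).imK := by
  have hre : ((g : ℍ[ℝ]) * v * star (g : ℍ[ℝ])).re = 0 := by
    simp [hv0]
    ring
  have e : (g : ℍ[ℝ]) * star (g : ℍ[ℝ]) = 1 := Unitary.coe_mul_star_self g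
  refine ⟨hre, ?_⟩
  rw [vertexRotor_eq hre, Submonoid.coe_mul, Submonoid.coe_mul, hv, vertexRotor_eq hv0, mul_add,
    add_mul, coe_inv, mul_smul_comm, smul_mul_assoc, ← Quaternion.coe_commutes, mul_assoc,
    e, mul_one]

/-- Conjugating a vertex rotor by an element of H gives a rotor in H, whose axis is again a vertex
by `mem_vertices`. -/
theorem IsIcosahedral.le_binaryIcosahedralGroup {H : Subgroup UnitQuat} (hH : IsIcosahedral H)
    (h0 : HasRotor H 0 1 goldenRatio) (h1 : HasRotor H 0 (-1) goldenRatio) :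
    H ≤ binaryIcosahedralGroup := by
  have key : ∀ g ∈ H, ∀ v ∈ icosahedronVertices,
      (g : ℍ[ℝ]) * v * star (g : ℍ[ℝ]) ∈ icosahedronVertices := by
    intro g hg v hv
    obtain ⟨hv0, k, hk, ek⟩ := hasRotor_of_mem h0 h1 hv
    obtain ⟨e1, e2⟩ := conj_vertexRotor (g := g) hv0 ek
    exact hH.mem_vertices h0 h1 (H.mul_mem (H.mul_mem hg hk) (H.inv_mem hg)) e1 e2
  intro g hg
  change (fun v : ℍ[ℝ] => (g : ℍ[ℝ]) * v * star (g : ℍ[ℝ])) '' icosahedronVertices =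
    icosahedronVertices
  refine Set.Subset.antisymm (Set.image_subset_iff.2 (key g hg)) fun v hv => ?_
  refine ⟨_, key g⁻¹ (H.inv_mem hg) v hv, ?_⟩
  have e : (g : ℍ[ℝ]) * star (g : ℍ[ℝ]) = 1 := Unitary.coe_mul_star_self g
  simp only [coe_inv, star_star]
  calc (g : ℍ[ℝ]) * (star (g : ℍ[ℝ]) * v * g) * star (g : ℍ[ℝ])
      = ((g : ℍ[ℝ]) * star (g : ℍ[ℝ])) * v * ((g : ℍ[ℝ]) * star (g : ℍ[ℝ])) := by
        simp only [mul_assoc]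
    _ = v := by rw [e, one_mul, mul_one]

end

end UnitQuat

/-! ### Uniqueness of the icosahedral group up to conjugation -/

namespace UnitQuat

open Real

theorem neg_one_mem_binaryIcosahedralGroup : (-1 : UnitQuat) ∈ binaryIcosahedralGroup := by
  change (fun v : ℍ[ℝ] => ((-1 : UnitQuat) : ℍ[ℝ]) * v * star ((-1 : UnitQuat) : ℍ[ℝ])) ''
    icosahedronVertices = icosahedronVertices
  simp

theorem eq_or_eq_neg_of_commute {u v : UnitQuat} (hu : u * u = -1) (hv : v * v = -1)
    (h : u * v = v * u) : v = u ∨ v = -u := by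
  have h1 : (u * v) * (u * v) = 1 := by
    calc (u * v) * (u * v) = u * (v * u) * v := by group
      _ = (u * u) * (v * v) := by rw [← h]; group
      _ = 1 := by rw [hu, hv]; simp
  have h2 : v = -(u * (u * v)) := by rw [← mul_assoc, hu]; simp
  rcases sq_eq_one_iff.1 h1 with h' | h' <;> rw [h'] at h2
  · right; simpa using h2
  · left; simpa using h2

/-- An element g is determined up to sign by g r g⁻¹ and g s g⁻¹, because only ±1 commutes with both
r and s. These conjugates are vertex rotors, so there are finitely many possibilities. -/
theorem finite_binaryIcosahedralGroup {r s : UnitQuat} {a b : ℍ[ℝ]}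
    (ha : a ∈ icosahedronVertices) (hb : b ∈ icosahedronVertices) (ha0 : a.re = 0) (hb0 : b.re = 0)
    (er : (r : ℍ[ℝ]) = vertexRotor a.imI a.imJ a.imK)
    (es : (s : ℍ[ℝ]) = vertexRotor b.imI b.imJ b.imK) (hrs : r * s ≠ s * r) :
    Finite binaryIcosahedralGroup := by
  set V : Set UnitQuat := {q | ∃ v ∈ icosahedronVertices,
    (q : ℍ[ℝ]) = vertexRotor v.imI v.imJ v.imK} with hV
  have hVfin : V.Finite := by
    refine Set.Finite.of_finite_image
      ((finite_icosahedronVertices.image fun v => vertexRotor v.imI v.imJ v.imK).subset ?_)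
      Subtype.val_injective.injOn
    rintro _ ⟨q, ⟨v, hv, e⟩, rfl⟩
    exact ⟨v, hv, e.symm⟩
  have hmem : ∀ g ∈ binaryIcosahedralGroup, ∀ v ∈ icosahedronVertices,
      (g : ℍ[ℝ]) * v * star (g : ℍ[ℝ]) ∈ icosahedronVertices := by
    intro g hg v hv
    have : (fun v : ℍ[ℝ] => (g : ℍ[ℝ]) * v * star (g : ℍ[ℝ])) '' icosahedronVertices =
      icosahedronVertices := hg
    rw [← this]
    exact ⟨v, hv, rfl⟩
  refine Set.Finite.of_finite_fibers (fun q : UnitQuat => (q * r * q⁻¹, q * s * q⁻¹))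
    ((hVfin.prod hVfin).subset ?_) ?_
  · rintro _ ⟨g, hg, rfl⟩
    exact ⟨⟨_, hmem g hg a ha, (conj_vertexRotor ha0 er).2⟩,
      ⟨_, hmem g hg b hb, (conj_vertexRotor hb0 es).2⟩⟩
  · rintro _ ⟨g, hg, rfl⟩
    refine (Set.toFinite {g, -g}).subset ?_
    rintro q ⟨-, hq⟩
    simp only [Set.mem_preimage, Set.mem_singleton_iff, Prod.mk.injEq] at hq
    have comm : ∀ x : UnitQuat, q * x * q⁻¹ = g * x * g⁻¹ → g⁻¹ * q * x = x * (g⁻¹ * q) := by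
      intro x hx
      calc g⁻¹ * q * x = g⁻¹ * (q * x * q⁻¹) * q := by group
        _ = x * (g⁻¹ * q) := by rw [hx]; group
    have h1 := comm r hq.1
    have h2 := comm s hq.2
    by_cases e1 : g⁻¹ * q = 1
    · left; exact (inv_mul_eq_one.1 e1).symm
    · by_cases e2 : g⁻¹ * q = -1
      · right; rw [inv_mul_eq_iff_eq_mul] at e2; simpa using e2
      · exact absurd (commute_of_commute e1 e2 h1 h2) hrs

theorem IsIcosahedral.exists_rotor {H : Subgroup UnitQuat} (hH : IsIcosahedral H) :
    ∃ v ∈ poles H, Nat.card (axisStab H v) = 10 ∧ ∃ r ∈ axisStab H v, 2 * r.1.re = goldenRatio := by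
  have := hH.finite
  obtain ⟨v, hv, h10⟩ := hH.exists_ten
  have := finite_axisStab H v
  have := Fact.mk Nat.prime_five
  obtain ⟨g, hg⟩ := exists_prime_orderOf_dvd_card' (G := axisStab H v) 5 (by rw [h10]; norm_num)
  have hneg := neg_one_mem_axisStab hH.neg_one_mem v
  have hg5 : (g : UnitQuat) ^ 5 = 1 := by
    have : g ^ 5 = 1 := by rw [← hg]; exact pow_orderOf_eq_one g
    exact congrArg Subtype.val this
  have hg1 : (g : UnitQuat) ≠ 1 := by
    intro h
    have : g = 1 := Subtype.ext h
    rw [this, orderOf_one] at hg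
    norm_num at hg
  have negmem : ∀ x ∈ axisStab H v, -x ∈ axisStab H v := fun x hx => by
    rw [← neg_one_mul]; exact mul_mem hneg hx
  refine ⟨v, hv, h10, ?_⟩
  have hφ := goldenRatio_sq
  -- The trace of an element of order five is φ - 1 or -φ. In the first case g² has trace (φ - 1)² -
  -- 2 = -φ, so a sign gives φ in both.
  rcases re_of_pow_five hg5 hg1 with h | h
  · refine ⟨-(g : UnitQuat) ^ 2, negmem _ (pow_mem g.2 2), ?_⟩
    have := re_pow_two g
    rw [h] at this
    rw [coe_neg, Quaternion.re_neg]
    linear_combination -this - hφ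
  · refine ⟨-(g : UnitQuat), negmem _ g.2, ?_⟩
    rw [coe_neg, Quaternion.re_neg]
    linear_combination -h

/-- An icosahedral group contains two rotors about adjacent vertices of an icosahedron. -/
theorem IsIcosahedral.exists_adjacent {H : Subgroup UnitQuat} (hH : IsIcosahedral H) :
    ∃ h ∈ H, ∃ k ∈ H, 2 * h.1.re = goldenRatio ∧ 2 * k.1.re = goldenRatio ∧
      2 * (h * k).1.re = 1 ∧ h * k ≠ k * h := by
  classical
  have := hH.finite
  obtain ⟨v, hv, h10, r, hr, hre⟩ := hH.exists_rotor
  obtain ⟨hrH, hrv⟩ := mem_axisStab.1 hr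
  obtain ⟨p1, p2⟩ := goldenRatio_bounds
  have ne_pm : ∀ q : UnitQuat, 2 * q.1.re = goldenRatio → q ≠ 1 ∧ q ≠ -1 := by
    intro q hq
    constructor
    · intro h; rw [eq_one_iff_re] at h; linarith
    · intro h; rw [eq_neg_one_iff_re] at h; linarith
  -- The orbit of v has 120 / 10 = 12 elements and cannot lie in {v, -v}.
  obtain ⟨g, hg, hg1, hg2⟩ : ∃ g ∈ H, g * v * g⁻¹ ≠ v ∧ g * v * g⁻¹ ≠ -v := by
    by_contra! hcon
    have h1 := card_orbit_mul_card_axisStab H ⟨v, hv⟩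
    rw [hH.card_eq, h10] at h1
    have h2 : Subtype.val '' (MulAction.orbit H (⟨v, hv⟩ : poles H)) ⊆ {v, -v} := by
      rintro _ ⟨_, ⟨g, rfl⟩, rfl⟩
      by_cases hc : (g : UnitQuat) * v * (g : UnitQuat)⁻¹ = v
      · left; exact hc
      · right; exact hcon g g.2 hc
    have h3 := Set.ncard_le_ncard h2 (Set.toFinite _)
    rw [Set.ncard_image_of_injective _ Subtype.val_injective] at h3
    have h4 := Set.ncard_insert_le v {-v}
    rw [Set.ncard_singleton] at h4
    rw [Nat.card_coe_set_eq] at h1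
    omega
  have hr' : g * r * g⁻¹ ∈ H := H.mul_mem (H.mul_mem hg hrH) (H.inv_mem hg)
  have hre' : 2 * (g * r * g⁻¹).1.re = goldenRatio := by rw [re_conj]; exact hre
  have hw : g * v * g⁻¹ * (g * v * g⁻¹) = -1 := conj_mul_self hv.1
  have hcomm : g * r * g⁻¹ * (g * v * g⁻¹) = g * v * g⁻¹ * (g * r * g⁻¹) := conj_commute hrv
  set r' := g * r * g⁻¹ with hr'def
  have hnc : r * r' ≠ r' * r := by
    intro h
    have h1 := ne_pm r hre
    have h2 := ne_pm r' hre'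
    have h3 : v * r' = r' * v := commute_of_commute h1.1 h1.2 hrv h
    have h4 := commute_of_commute h2.1 h2.2 h3.symm hcomm
    rcases eq_or_eq_neg_of_commute hv.1 hw h4 with h | h
    · exact hg1 h
    · exact hg2 h
  rcases hH.re_mul_cases hrH hr' hre hre' with h | h | ⟨h, -⟩ | ⟨-, h⟩
  · exact absurd (by rw [h, mul_eq_one_comm.1 h]) hnc
  · rw [mul_inv_eq_one] at h
    exact absurd (by rw [← h]) hnc
  · exact ⟨r, hrH, r', hr', hre, hre', h, hnc⟩
  -- Replacing the second rotor by its inverse exchanges the traces 1 and φ.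
  · refine ⟨r, hrH, r'⁻¹, H.inv_mem hr', hre, by rw [re_inv]; exact hre', h, ?_⟩
    intro h'
    apply hnc
    calc r * r' = r' * (r'⁻¹ * r) * r' := by group
      _ = r' * r := by rw [← h']; group

/-- Conjugation preserves icosahedral type. -/
theorem IsIcosahedral.map_conj {H : Subgroup UnitQuat} (hH : IsIcosahedral H) (c : UnitQuat) :
    IsIcosahedral (H.map (MulAut.conj c).toMonoidHom) := by
  have hcard : ∀ K : Subgroup UnitQuat, Nat.card (K.map (MulAut.conj c).toMonoidHom) = Nat.card K :=
    fun K => Subgroup.card_map_of_injective (MulAut.conj c).injective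
  have hmem : ∀ (K : Subgroup UnitQuat) (x : UnitQuat),
      x ∈ K.map (MulAut.conj c).toMonoidHom ↔ c⁻¹ * x * c ∈ K := by
    intro K x
    constructor
    · rintro ⟨k, hk, rfl⟩
      simpa [mul_assoc] using hk
    · intro h
      exact ⟨_, h, by simp [mul_assoc]⟩
  have hst : ∀ v, axisStab (H.map (MulAut.conj c).toMonoidHom) v =
      (axisStab H (c⁻¹ * v * c)).map (MulAut.conj c).toMonoidHom := by
    intro v
    ext x
    rw [hmem, mem_axisStab, mem_axisStab, hmem]
    refine and_congr_right fun _ => ⟨fun h => ?_, fun h => ?_⟩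
    · have := conj_commute (g := c⁻¹) h
      rwa [inv_inv] at this
    · have := conj_commute (g := c) h
      simpa [mul_assoc] using this
  have hp : ∀ v, v ∈ poles (H.map (MulAut.conj c).toMonoidHom) → c⁻¹ * v * c ∈ poles H := by
    rintro v ⟨hv, h, hh, h1, h2, h3⟩
    rw [hmem] at hh
    have a1 := conj_mul_self (g := c⁻¹) hv
    have a2 := conj_ne_one (g := c⁻¹) h1 h2
    have a3 := conj_commute (g := c⁻¹) h3
    rw [inv_inv] at a1 a2 a3
    exact ⟨a1, _, hh, a2.1, a2.2, a3⟩
  refine ⟨(hmem _ _).2 (by simpa using hH.neg_one_mem), by rw [hcard, hH.card_eq], ?_, ?_⟩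
  · intro v hv
    rw [hst, hcard]
    exact hH.card_axisStab _ (hp v hv)
  · obtain ⟨v, ⟨hv, h, hh, h1, h2, h3⟩, h10⟩ := hH.exists_ten
    refine ⟨c * v * c⁻¹, ⟨conj_mul_self hv, c * h * c⁻¹, ⟨h, hh, rfl⟩, (conj_ne_one h1 h2).1,
      (conj_ne_one h1 h2).2, conj_commute h3⟩, ?_⟩
    rw [hst, hcard, ← h10]
    congr 3
    group

/-- Every group of icosahedral type is conjugate to the binary icosahedral group. -/
theorem IsIcosahedral.exists_conj_eq {H : Subgroup UnitQuat} (hH : IsIcosahedral H) :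
    ∃ c : UnitQuat, H.map (MulAut.conj c).toMonoidHom = binaryIcosahedralGroup := by
  have hφ := goldenRatio_sq
  have hi : (goldenRatio - 1) * goldenRatio = 1 := by linear_combination hφ
  obtain ⟨h, hh, k, hk, h2, k2, hk1, hnc⟩ := hH.exists_adjacent
  obtain ⟨r, er⟩ : ∃ r : UnitQuat, (r : ℍ[ℝ]) = vertexRotor 0 1 goldenRatio :=
    ⟨⟨_, vertexRotor_mem (by linear_combination hφ)⟩, rfl⟩
  obtain ⟨s, es⟩ : ∃ s : UnitQuat, (s : ℍ[ℝ]) = vertexRotor 0 (-1) goldenRatio :=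
    ⟨⟨_, vertexRotor_mem (by linear_combination hφ)⟩, rfl⟩
  have hrs : 4 * (r * s).1.re = 2 := by
    rw [re_mul_vertexRotor er es]
    linear_combination (goldenRatio - 1) * hφ
  have r2 : r.1.re = goldenRatio / 2 := by rw [er, re_vertexRotor]
  have s2 : s.1.re = goldenRatio / 2 := by rw [es, re_vertexRotor]
  obtain ⟨c₁, hc₁⟩ := UnitQuat.exists_conj_eq (h := h) (h' := r) (by rw [r2]; linarith)
  -- The first conjugation moves h to r; the second fixes r and moves the conjugate of k to s.
  obtain ⟨c₂, hc₂, hc₂'⟩ := exists_conj_fixing (h := r) (k := c₁ * k * c₁⁻¹) (k' := s)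
    (by rw [re_conj, s2]; linarith)
    (by
      rw [← hc₁]
      have : c₁ * h * c₁⁻¹ * (c₁ * k * c₁⁻¹) = c₁ * (h * k) * c₁⁻¹ := by group
      rw [this, re_conj, hc₁]
      linarith)
    (by
      intro he
      apply hnc
      rw [← hc₁] at he
      have := conj_commute (g := c₁⁻¹) he
      simpa [mul_assoc] using this)
  set H' := H.map (MulAut.conj (c₂ * c₁)).toMonoidHom with hH'
  have hI : IsIcosahedral H' := hH.map_conj _
  have hr : r ∈ H' := ⟨h, hh, by
    rw [← hc₂, ← hc₁]; simp [mul_assoc]⟩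
  have hs : s ∈ H' := ⟨k, hk, by
    rw [← hc₂']; simp [mul_assoc]⟩
  have hle : H' ≤ binaryIcosahedralGroup :=
    hI.le_binaryIcosahedralGroup ⟨r, hr, er⟩ ⟨s, hs, es⟩
  have hncrs : r * s ≠ s * r := by
    intro he
    have hre := congrArg (fun q : UnitQuat => q.1.imI) he
    simp only [Submonoid.coe_mul, er, es, Quaternion.imI_mul, re_vertexRotor, imI_vertexRotor,
      imJ_vertexRotor, imK_vertexRotor] at hre
    have : (goldenRatio - 1) * ((goldenRatio - 1) * goldenRatio) = 0 := by
      linear_combination hre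
    rw [hi] at this
    obtain ⟨p1, p2⟩ := goldenRatio_bounds
    linarith
  have hfin : Finite binaryIcosahedralGroup :=
    finite_binaryIcosahedralGroup (r := r) (s := s) (a := ⟨0, 0, 1, goldenRatio⟩)
      (b := ⟨0, 0, -1, goldenRatio⟩)
      ⟨1, goldenRatio, Or.inl rfl, Or.inl rfl, Or.inl rfl⟩
      ⟨-1, goldenRatio, Or.inr rfl, Or.inl rfl, Or.inl rfl⟩ rfl rfl er es hncrs
  have hcard : Nat.card H' ≤ Nat.card binaryIcosahedralGroup := Subgroup.card_le_of_le hle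
  rw [hI.card_eq] at hcard
  refine ⟨c₂ * c₁, ?_⟩
  -- The order of the binary icosahedral group is not computed but bounded by `classification`: 24
  -- and 48 are too small to contain H', and an abelian subgroup of index at most two is excluded by
  -- r and s.
  have h120 : Nat.card binaryIcosahedralGroup ≤ 120 := by
    rcases classification binaryIcosahedralGroup neg_one_mem_binaryIcosahedralGroup with
      ⟨v, hv, hle2⟩ | h | h | h
    · exfalso
      set A := (axisStab binaryIcosahedralGroup v).subgroupOf binaryIcosahedralGroup with hA
      have hsq : ∀ q ∈ binaryIcosahedralGroup, q * q ∈ axisStab binaryIcosahedralGroup v := by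
        have hcardA : Nat.card A = Nat.card (axisStab binaryIcosahedralGroup v) :=
          Nat.card_congr (Subgroup.subgroupOfEquivOfLe (axisStab_le _ v)).toEquiv
        have := finite_axisStab binaryIcosahedralGroup v
        have hpos : 0 < Nat.card (axisStab binaryIcosahedralGroup v) := Nat.card_pos
        have hi := A.card_mul_index
        rw [← hi, hcardA, mul_comm] at hle2
        have hi2 := le_of_mul_le_mul_right hle2 hpos
        have hi0 : A.index ≠ 0 := Subgroup.FiniteIndex.index_ne_zero
        intro q hq
        have : A.index = 1 ∨ A.index = 2 := by omega
        rcases this with h | h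
        · have : (⟨q, hq⟩ * ⟨q, hq⟩ : binaryIcosahedralGroup) ∈ A := by
            rw [Subgroup.index_eq_one.1 h]; trivial
          exact Subgroup.mem_subgroupOf.1 this
        · exact Subgroup.mem_subgroupOf.1
            (Subgroup.mul_self_mem_of_index_two h (⟨q, hq⟩ : binaryIcosahedralGroup))
      have m1 := (mem_axisStab.1 (hsq r (hle hr))).2
      have m2 := (mem_axisStab.1 (hsq s (hle hs))).2
      have hv' := ne_one_of_mul_self hv
      have h1 := commute_of_commute hv'.1 hv'.2 m1.symm m2.symm
      have p : goldenRatio ≠ 0 := by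
        obtain ⟨p1, p2⟩ := goldenRatio_bounds
        linarith
      apply hncrs
      -- From r² = φ r - 1 and s² = φ s - 1, commuting squares force r and s to commute.
      have e1 := mul_self_eq r
      have e2 := mul_self_eq s
      have h1' := congrArg Subtype.val h1
      simp only [Submonoid.coe_mul] at h1'
      rw [e1, e2, r2, s2, mul_div_cancel₀ _ two_ne_zero, Quaternion.coe_mul_eq_smul,
        Quaternion.coe_mul_eq_smul] at h1'
      simp only [sub_mul, mul_sub, one_mul, mul_one, smul_mul_smul_comm] at h1'
      have h3 : (goldenRatio * goldenRatio) • ((r : ℍ[ℝ]) * s) =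
          (goldenRatio * goldenRatio) • ((s : ℍ[ℝ]) * r) := by
        refine sub_eq_zero.1 (Eq.trans ?_ (sub_eq_zero.2 h1'))
        abel
      exact Subtype.ext (smul_right_injective ℍ[ℝ] (mul_ne_zero p p) h3)
    · rw [h] at hcard; norm_num at hcard
    · rw [h] at hcard; norm_num at hcard
    · exact h.card_eq.le
  exact Subgroup.eq_of_le_of_card_ge hle (by rw [hI.card_eq]; exact h120)

end UnitQuat

/-! ### The groups SL₂(p): perfectness and order -/

namespace Matrix.SpecialLinearGroup

theorem isPerfect_zmod (p : ℕ) [Fact p.Prime] (hp : 3 < p) :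
    Group.IsPerfect (Matrix.SpecialLinearGroup (Fin 2) (ZMod p)) := by
  have h2 : (2 : ZMod p) ≠ 0 := by
    intro h
    have := (ZMod.natCast_eq_zero_iff 2 p).1 (by exact_mod_cast h)
    have := Nat.le_of_dvd (by norm_num) this
    omega
  have h3 : (3 : ZMod p) ≠ 0 := by
    intro h
    have := (ZMod.natCast_eq_zero_iff 3 p).1 (by exact_mod_cast h)
    have := Nat.le_of_dvd (by norm_num) this
    omega
  -- The scalar 2 is nonzero and its square differs from 1, because 2² - 1 = 3 and p > 3.
  refine ⟨SL2.commutator_eq_top (a := (2 : ZMod p)) h2 fun h => h3 ?_⟩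
  linear_combination h

/-- The upper unipotent matrices form a subgroup of order p. -/
theorem prime_dvd_card_zmod (p : ℕ) [Fact p.Prime] :
    p ∣ Nat.card (Matrix.SpecialLinearGroup (Fin 2) (ZMod p)) := by
  let f : Multiplicative (ZMod p) →* Matrix.SpecialLinearGroup (Fin 2) (ZMod p) :=
    { toFun := fun b => transvection zero_ne_one b.toAdd
      map_one' := by simp
      map_mul' := fun a b => transvection_add _ _ _ }
  have hf : Function.Injective f := by
    intro a b h
    have := congrArg (fun M : Matrix.SpecialLinearGroup (Fin 2) (ZMod p) => M 0 1) h
    simpa [f, transvection_coe] using this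
  have := Subgroup.card_dvd_of_injective f hf
  simpa using this

theorem card_zmod_five : Nat.card (Matrix.SpecialLinearGroup (Fin 2) (ZMod 5)) = 120 := by
  rw [Nat.card_eq_fintype_card]
  decide +kernel

end Matrix.SpecialLinearGroup

/-! ### Perfect quotients and solvable groups -/

section GroupTheory

variable {G S A B : Type*} [Group G] [Group S] [Group A] [Group B]

/-- A surjection onto a perfect group stays surjective on the kernel of any homomorphism to a
solvable group. -/
theorem Group.IsPerfect.map_ker_eq_top [Group.IsPerfect S] {F : G →* S}
    (hF : Function.Surjective F) (π : G →* A) [Group.IsSolvable A] : π.ker.map F = ⊤ := by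
  have hn : (π.ker.map F).Normal := Subgroup.Normal.map inferInstance F hF
  have h1 : Group.IsSolvable (G ⧸ π.ker) :=
    Group.isSolvable_of_isSolvable_injective (QuotientGroup.kerLift_injective π)
  -- The quotient of S by the image of ker π is a quotient of G / ker π, hence solvable; it is also
  -- perfect, hence trivial.
  have hsurj : Function.Surjective (QuotientGroup.map π.ker (π.ker.map F) F
      (Subgroup.le_comap_map F π.ker)) := by
    intro x
    obtain ⟨s, rfl⟩ := QuotientGroup.mk_surjective x
    obtain ⟨g, rfl⟩ := hF s
    exact ⟨(g : G ⧸ π.ker), rfl⟩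
  have h2 : Group.IsSolvable (S ⧸ π.ker.map F) := Group.isSolvable_of_surjective hsurj
  rw [← QuotientGroup.subsingleton_iff]
  by_contra h3
  rw [not_subsingleton_iff_nontrivial] at h3
  exact Group.IsPerfect.not_isSolvable (S ⧸ π.ker.map F) h2

/-- The group ker π embeds in B through ρ and maps onto the nontrivial perfect group S. -/
theorem Group.IsPerfect.not_isSolvable_of_ker [Group.IsPerfect S] [Nontrivial S] {F : G →* S}
    (π : G →* A) (ρ : G →* B) (hker : π.ker.map F = ⊤)
    (hinj : ∀ g, π g = 1 → ρ g = 1 → g = 1) :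
    Nat.card S ∣ Nat.card π.ker ∧ ¬ Group.IsSolvable B := by
  let F' : π.ker →* S := F.comp π.ker.subtype
  have hF' : Function.Surjective F' := by
    intro s
    have : s ∈ π.ker.map F := by rw [hker]; trivial
    obtain ⟨g, hg, rfl⟩ := this
    exact ⟨⟨g, hg⟩, rfl⟩
  have hρ : Function.Injective (ρ.comp π.ker.subtype) := by
    rw [injective_iff_map_eq_one]
    intro g hg
    exact Subtype.ext (hinj g g.2 hg)
  refine ⟨Subgroup.card_dvd_of_surjective F' hF', fun hB => ?_⟩
  have := Group.isSolvable_of_isSolvable_injective hρ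
  exact Group.IsPerfect.not_isSolvable S (Group.isSolvable_of_surjective hF')

end GroupTheory

/-! ### Finite subgroups of S³ × S³ with a perfect quotient -/

namespace UnitQuat

variable {S : Type*} [Group S]

/-- The first projection of a subgroup of `S³ × S³`. -/
noncomputable abbrev left (G : Subgroup (UnitQuat × UnitQuat)) : Subgroup UnitQuat :=
  G.map (MonoidHom.fst _ _)

/-- The second projection of a subgroup of `S³ × S³`. -/
noncomputable abbrev right (G : Subgroup (UnitQuat × UnitQuat)) : Subgroup UnitQuat :=
  G.map (MonoidHom.snd _ _)

/-- The projection onto the left factor. -/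
noncomputable def toLeft (G : Subgroup (UnitQuat × UnitQuat)) : G →* left G :=
  (MonoidHom.fst _ _).subgroupMap G

/-- The projection onto the right factor. -/
noncomputable def toRight (G : Subgroup (UnitQuat × UnitQuat)) : G →* right G :=
  (MonoidHom.snd _ _).subgroupMap G

variable {G : Subgroup (UnitQuat × UnitQuat)}

theorem coe_toRight (g : G) : (toRight G g : UnitQuat) = g.1.2 := rfl

theorem toLeft_surjective : Function.Surjective (toLeft G) :=
  MonoidHom.subgroupMap_surjective _ _

theorem toRight_surjective : Function.Surjective (toRight G) :=
  MonoidHom.subgroupMap_surjective _ _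

theorem toLeft_eq_one {g : G} : toLeft G g = 1 ↔ g.1.1 = 1 := by
  rw [← Subtype.coe_inj]; rfl

theorem toRight_eq_one {g : G} : toRight G g = 1 ↔ g.1.2 = 1 := by
  rw [← Subtype.coe_inj]; rfl

theorem eq_one_of_toLeft_of_toRight (g : G) (h1 : toLeft G g = 1) (h2 : toRight G g = 1) :
    g = 1 :=
  Subtype.ext (Prod.ext (toLeft_eq_one.1 h1) (toRight_eq_one.1 h2))

instance [Finite G] : Finite (left G) := Finite.of_surjective _ toLeft_surjective
instance [Finite G] : Finite (right G) := Finite.of_surjective _ toRight_surjective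

theorem neg_one_mem_left (hneg : ((-1, -1) : UnitQuat × UnitQuat) ∈ G) : -1 ∈ left G :=
  ⟨_, hneg, rfl⟩

theorem neg_one_mem_right (hneg : ((-1, -1) : UnitQuat × UnitQuat) ∈ G) : -1 ∈ right G :=
  ⟨_, hneg, rfl⟩

theorem card_ker_toLeft_dvd [Finite G] : Nat.card (toLeft G).ker ∣ Nat.card (right G) :=
  Subgroup.card_dvd_of_injective ((toRight G).comp (toLeft G).ker.subtype) (by
    rw [injective_iff_map_eq_one]
    intro g hg
    exact Subtype.ext (eq_one_of_toLeft_of_toRight g.1 g.2 hg))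

theorem card_ker_toRight_dvd [Finite G] : Nat.card (toRight G).ker ∣ Nat.card (left G) :=
  Subgroup.card_dvd_of_injective ((toLeft G).comp (toRight G).ker.subtype) (by
    rw [injective_iff_map_eq_one]
    intro g hg
    exact Subtype.ext (eq_one_of_toLeft_of_toRight g.1 hg g.2))

theorem isSolvable_or {H : Subgroup UnitQuat} [Finite H] (hneg : -1 ∈ H) :
    Group.IsSolvable H ∨ Nat.card H = 24 ∨ Nat.card H = 48 ∨ IsIcosahedral H := by
  rcases classification H hneg with ⟨v, hv, h⟩ | h
  · exact Or.inl (isSolvable_of_card_le_two_mul hv h)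
  · exact Or.inr h

/-- Neither 24 nor 48 has a prime factor greater than 3, and 120 has only 5. -/
theorem isIcosahedral_of_prime_dvd {H : Subgroup UnitQuat} [Finite H] (hneg : -1 ∈ H)
    (hs : ¬ Group.IsSolvable H) {p : ℕ} (hp : p.Prime) (hp3 : 3 < p) (hpH : p ∣ Nat.card H) :
    p = 5 ∧ IsIcosahedral H := by
  have key : ∀ n : ℕ, n ≠ 0 → p ∣ n → n.primeFactors ⊆ {2, 3, 5} → p = 5 := by
    intro n hn hpn hn'
    have := hn' (Nat.mem_primeFactors.2 ⟨hp, hpn, hn⟩)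
    simp only [Finset.mem_insert, Finset.mem_singleton] at this
    omega
  rcases isSolvable_or hneg with h | h | h | h
  · exact absurd h hs
  · rw [h] at hpH
    have := key 24 (by norm_num) hpH (by decide +kernel)
    subst this; norm_num at hpH
  · rw [h] at hpH
    have := key 48 (by norm_num) hpH (by decide +kernel)
    subst this; norm_num at hpH
  · refine ⟨?_, h⟩
    rw [h.card_eq] at hpH
    exact key 120 (by norm_num) hpH (by decide +kernel)

/-- If a finite subgroup of `S³ × S³` maps onto a perfect group of order divisible by a prime
`p > 3`, then `p = 5` and one of its projections is icosahedral. -/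
theorem exists_isIcosahedral [Finite G] (hneg : ((-1, -1) : UnitQuat × UnitQuat) ∈ G)
    [Group.IsPerfect S] [Nontrivial S] {F : G →* S} (hF : Function.Surjective F) {p : ℕ}
    (hp : p.Prime) (hp3 : 3 < p) (hpS : p ∣ Nat.card S) :
    p = 5 ∧ (IsIcosahedral (left G) ∨ IsIcosahedral (right G)) := by
  have hl := neg_one_mem_left hneg
  have hr := neg_one_mem_right hneg
  by_cases sl : Group.IsSolvable (left G)
  · obtain ⟨h1, h2⟩ := Group.IsPerfect.not_isSolvable_of_ker (toLeft G) (toRight G)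
      (Group.IsPerfect.map_ker_eq_top hF (toLeft G)) eq_one_of_toLeft_of_toRight
    obtain ⟨h3, h4⟩ := isIcosahedral_of_prime_dvd hr h2 hp hp3
      ((hpS.trans h1).trans card_ker_toLeft_dvd)
    exact ⟨h3, Or.inr h4⟩
  by_cases sr : Group.IsSolvable (right G)
  · obtain ⟨h1, h2⟩ := Group.IsPerfect.not_isSolvable_of_ker (toRight G) (toLeft G)
      (Group.IsPerfect.map_ker_eq_top hF (toRight G))
      (fun g h1 h2 => eq_one_of_toLeft_of_toRight g h2 h1)
    obtain ⟨h3, h4⟩ := isIcosahedral_of_prime_dvd hl h2 hp hp3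
      ((hpS.trans h1).trans card_ker_toRight_dvd)
    exact ⟨h3, Or.inl h4⟩
  -- If neither projection is solvable, p divides |L| |R|, so it divides one of the two orders.
  · have hinj : Function.Injective ((toLeft G).prod (toRight G)) := by
      rw [injective_iff_map_eq_one]
      intro g hg
      exact eq_one_of_toLeft_of_toRight g (congrArg Prod.fst hg) (congrArg Prod.snd hg)
    have h1 := (hpS.trans (Subgroup.card_dvd_of_surjective F hF)).trans
      (Subgroup.card_dvd_of_injective _ hinj)
    rw [Nat.card_prod] at h1
    rcases (Nat.Prime.dvd_mul hp).1 h1 with h | h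
    · obtain ⟨h3, h4⟩ := isIcosahedral_of_prime_dvd hl sl hp hp3 h
      exact ⟨h3, Or.inl h4⟩
    · obtain ⟨h3, h4⟩ := isIcosahedral_of_prime_dvd hr sr hp hp3 h
      exact ⟨h3, Or.inr h4⟩

theorem re_of_pow_three {h : UnitQuat} (hh : h ^ 3 = 1) (h1 : h ≠ 1) : 2 * h.1.re = -1 := by
  have h2 := re_pow_three h
  have e1 : ((1 : UnitQuat) : ℍ[ℝ]).re = 1 := rfl
  rw [hh, e1] at h2
  have : (2 * h.1.re - 2) * (2 * h.1.re + 1) ^ 2 = 0 := by linear_combination -h2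
  rcases mul_eq_zero.1 this with h | h
  · exact absurd (eq_one_iff_re.2 (by linarith)) h1
  · have := pow_eq_zero_iff two_ne_zero |>.1 h
    linarith

/-- The kernel of the right projection consists of pairs (l, 1) and embeds in the left projection;
equality of orders makes the embedding onto. -/
theorem mem_of_card_le_ker_toRight [Finite G] (h : Nat.card (left G) ≤ Nat.card (toRight G).ker)
    {l : UnitQuat} (hl : l ∈ left G) : (l, (1 : UnitQuat)) ∈ G := by
  have hinj : Function.Injective ((toLeft G).comp (toRight G).ker.subtype) := by
    rw [injective_iff_map_eq_one]
    intro g hg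
    exact Subtype.ext (eq_one_of_toLeft_of_toRight g.1 hg g.2)
  obtain ⟨g, hg⟩ := (hinj.bijective_of_nat_card_le h).2 ⟨l, hl⟩
  have e : g.1.1 = (l, 1) := Prod.ext (congrArg Subtype.val hg) (toRight_eq_one.1 g.2)
  rw [← e]; exact g.1.2

theorem mem_of_card_le_ker_toLeft [Finite G] (h : Nat.card (right G) ≤ Nat.card (toLeft G).ker)
    {r : UnitQuat} (hr : r ∈ right G) : ((1 : UnitQuat), r) ∈ G := by
  have hinj : Function.Injective ((toRight G).comp (toLeft G).ker.subtype) := by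
    rw [injective_iff_map_eq_one]
    intro g hg
    exact Subtype.ext (eq_one_of_toLeft_of_toRight g.1 g.2 hg)
  obtain ⟨g, hg⟩ := (hinj.bijective_of_nat_card_le h).2 ⟨r, hr⟩
  have e : g.1.1 = (1, r) := Prod.ext (toLeft_eq_one.1 g.2) (congrArg Subtype.val hg)
  rw [← e]; exact g.1.2

/-- Without pseudoreflections, the right projection is trivial up to sign. -/
theorem right_trivial_of_free [Finite G] (hneg : ((-1, -1) : UnitQuat × UnitQuat) ∈ G)
    [Group.IsPerfect S] [Nontrivial S] {F : G →* S} (hF : Function.Surjective F)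
    (hS : Nat.card S = 120) (hnegF : F ⟨_, hneg⟩ = 1)
    (hfree : ∀ g : G, g.1.1.1.re = g.1.2.1.re → g.1.1 = 1 ∨ g.1.1 = -1)
    (hker : ∀ g : G, F g = 1 → g.1 = 1 ∨ g.1 = (-1, -1)) (hL : IsIcosahedral (left G)) :
    (∀ l ∈ left G, (l, (1 : UnitQuat)) ∈ G) ∧ ∀ g ∈ G, g.2 = 1 ∨ g.2 = -1 := by
  -- The kernel of F is ±(1, 1), so |G| = 2 · 120, and the kernel of the projection to L, of order
  -- 120, has order two. It is {(1, 1), (1, -1)}, so signs may be changed in either coordinate.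
  have hkF : Nat.card F.ker = 2 := by
    have hne : (1 : G) ≠ ⟨_, hneg⟩ := by
      intro h
      have h1 : (1 : UnitQuat × UnitQuat) = (-1, -1) := congrArg Subtype.val h
      exact neg_ne 1 (congrArg Prod.fst h1).symm
    have : (F.ker : Set G) = {1, ⟨_, hneg⟩} := by
      ext g
      simp only [SetLike.mem_coe, MonoidHom.mem_ker, Set.mem_insert_iff, Set.mem_singleton_iff]
      constructor
      · intro h
        rcases hker g h with h | h
        · exact Or.inl (Subtype.ext h)
        · exact Or.inr (Subtype.ext h)
      · rintro (rfl | rfl)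
        · exact map_one F
        · exact hnegF
    rw [← Set.ncard_pair hne, ← this]
    rfl
  have hG : Nat.card G = 240 := by
    rw [← F.ker.card_mul_index, hkF, Subgroup.index_ker, MonoidHom.range_eq_top_of_surjective F hF,
      Subgroup.card_top, hS]
  have hkL : Nat.card (toLeft G).ker = 2 := by
    have := (toLeft G).ker.card_mul_index
    rw [Subgroup.index_ker, MonoidHom.range_eq_top_of_surjective _ toLeft_surjective,
      Subgroup.card_top, hL.card_eq, hG] at this
    omega
  have hker1 : ∀ r : UnitQuat, ((1 : UnitQuat), r) ∈ G → r = 1 ∨ r = -1 := by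
    intro r hr
    have h1 : (⟨(1, r), hr⟩ : G) ∈ (toLeft G).ker := toLeft_eq_one.2 rfl
    have h2 := Subgroup.orderOf_dvd_natCard _ h1
    rw [hkL, orderOf_dvd_iff_pow_eq_one] at h2
    have h3 := congrArg (fun g : G => g.1.2) h2
    refine sq_eq_one_iff.1 ?_
    rw [← pow_two]
    exact h3
  have hm : ((1 : UnitQuat), (-1 : UnitQuat)) ∈ G := by
    have : Nontrivial (toLeft G).ker := Finite.one_lt_card_iff_nontrivial.1 (by rw [hkL]; norm_num)
    obtain ⟨g, hg⟩ := exists_ne (1 : (toLeft G).ker)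
    have h1 : g.1.1.1 = 1 := toLeft_eq_one.1 g.2
    have e : g.1.1 = (1, g.1.1.2) := Prod.ext h1 rfl
    have hmem : ((1 : UnitQuat), g.1.1.2) ∈ G := by rw [← e]; exact g.1.2
    rcases hker1 _ hmem with h2 | h2
    · exact absurd (Subtype.ext (Subtype.ext (Prod.ext h1 h2))) hg
    · rwa [h2] at hmem
  have hm' : ((-1 : UnitQuat), (1 : UnitQuat)) ∈ G := by
    have := G.mul_mem hneg hm
    simpa using this
  have negL : ∀ l r : UnitQuat, (l, r) ∈ G → (-l, r) ∈ G := fun l r h => by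
    simpa using G.mul_mem hm' h
  have negR : ∀ l r : UnitQuat, (l, r) ∈ G → (l, -r) ∈ G := fun l r h => by
    simpa using G.mul_mem hm h
  have trivR : ∀ l r : UnitQuat, (l, r) ∈ G → r = 1 ∨ r = -1 → (l, (1 : UnitQuat)) ∈ G := by
    rintro l r h (rfl | rfl)
    · exact h
    · simpa using negR _ _ h
  have cube : ∀ l r : UnitQuat, (l, r) ∈ G → l ^ 3 = 1 → (l, (1 : UnitQuat)) ∈ G := by
    -- Two nontrivial cube roots of 1 have the same real part -1/2, which `hfree` forbids.
    have main : ∀ l r : UnitQuat, (l, r) ∈ G → l ^ 3 = 1 → r ^ 3 = 1 → (l, (1 : UnitQuat)) ∈ G := by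
      intro l r h hl hr
      by_cases h1 : r = 1
      · rwa [h1] at h
      by_cases h2 : l = 1
      · rw [h2]; exact one_mem G
      exfalso
      have a1 := re_of_pow_three hr h1
      have a2 := re_of_pow_three hl h2
      rcases hfree ⟨_, h⟩ (show l.1.re = r.1.re by linarith) with h3 | h3
      · exact h2 h3
      · rw [eq_neg_one_iff_re] at h3
        simp only at h3
        linarith
    intro l r h hl
    have h3 : ((1 : UnitQuat), r ^ 3) ∈ G := by
      have := G.pow_mem h 3
      rwa [Prod.pow_mk, hl] at this
    rcases hker1 _ h3 with h4 | h4
    · exact main l r h hl h4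
    · exact main l (-r) (negR _ _ h) hl (by rw [Odd.neg_pow (by decide), h4, neg_neg])
  -- For l² = -1 the partner r satisfies r² = ±1; r² = -1 would make both real parts zero, against
  -- `hfree`. Only elements with l⁵ = ±1 escape this comparison, since real parts of fifth roots of
  -- 1 take two values.
  have hcase : ∀ l r : UnitQuat, (l, r) ∈ G → (l, (1 : UnitQuat)) ∈ G ∨ l ^ 5 = 1 ∨ l ^ 5 = -1 := by
    intro l r h
    rcases hL.pow_eq ⟨_, h, rfl⟩ with h' | h' | h' | h' | h' | h'
    all_goals simp only [MonoidHom.coe_fst] at h'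
    · left
      rw [pow_two, sq_eq_one_iff] at h'
      rcases h' with rfl | rfl
      · exact one_mem G
      · exact hm'
    · left
      have h3 : ((1 : UnitQuat), r ^ 2) ∈ G := by
        have := G.mul_mem (G.pow_mem h 2) hm'
        simpa [Prod.pow_mk, h'] using this
      rcases hker1 _ h3 with h4 | h4
      · rw [pow_two, sq_eq_one_iff] at h4
        exact trivR l r h h4
      · exfalso
        rw [pow_two] at h' h4
        have a1 := mul_self_eq_neg_one_iff.1 h'
        have a2 := mul_self_eq_neg_one_iff.1 h4
        have := ne_one_of_mul_self h'
        rcases hfree ⟨_, h⟩ (a1.trans a2.symm) with h3 | h3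
        · exact this.1 h3
        · exact this.2 h3
    · left; exact cube l r h h'
    · left
      have := negL _ _ (cube (-l) r (negL _ _ h) (by
        rw [Odd.neg_pow (by decide), h', neg_neg]))
      rwa [neg_neg] at this
    · right; left; exact h'
    · right; right; exact h'
  have hR5 : ∀ r ∈ right G, r ^ 5 = 1 ∨ r ^ 5 = -1 := by
    rintro _ ⟨⟨l, r⟩, h, rfl⟩
    change r ^ 5 = 1 ∨ r ^ 5 = -1
    rcases hcase l r h with h' | h' | h'
    · have : ((1 : UnitQuat), r) ∈ G := by
        simpa using G.mul_mem (G.inv_mem h') h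
      rcases hker1 r this with rfl | rfl
      · left; simp
      · right; rw [Odd.neg_pow (by decide), one_pow]
    · refine hker1 _ ?_
      have := G.pow_mem h 5
      rwa [Prod.pow_mk, h'] at this
    · refine hker1 _ ?_
      have := G.pow_mem h 5
      rw [Prod.pow_mk, h'] at this
      simpa using negL _ _ this
  -- Since r⁵ = ±1 for all r in R, there is no element of order three. The orders 24, 48 and 120 are
  -- thereby excluded and R is solvable.
  have h3 : ¬ 3 ∣ Nat.card (right G) := by
    intro hd
    have := Fact.mk Nat.prime_three
    obtain ⟨x, hx⟩ := exists_prime_orderOf_dvd_card' (G := right G) 3 hd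
    have hx3 : x.1 ^ 3 = 1 := by
      have : x ^ 3 = 1 := by rw [← hx]; exact pow_orderOf_eq_one x
      exact congrArg Subtype.val this
    have hx10 : x.1 ^ 10 = 1 := by
      have : x.1 ^ 10 = (x.1 ^ 5) ^ 2 := by rw [← pow_mul]
      rcases hR5 x.1 x.2 with h | h <;> rw [this, h] <;> simp
    have hx1 : x.1 = 1 := by
      calc x.1 = x.1 ^ 10 * ((x.1 ^ 3) ^ 3)⁻¹ := by group
        _ = 1 := by rw [hx10, hx3]; simp
    have : x = 1 := Subtype.ext hx1
    rw [this, orderOf_one] at hx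
    norm_num at hx
  have hsol : Group.IsSolvable (right G) := by
    rcases isSolvable_or (neg_one_mem_right hneg) with h | h | h | h
    · exact h
    · rw [h] at h3; norm_num at h3
    · rw [h] at h3; norm_num at h3
    · rw [h.card_eq] at h3; norm_num at h3
  have hd := (Group.IsPerfect.not_isSolvable_of_ker (toRight G) (toLeft G)
    (Group.IsPerfect.map_ker_eq_top hF (toRight G))
    (fun g h1 h2 => eq_one_of_toLeft_of_toRight g h2 h1)).1
  have hmem : ∀ l ∈ left G, (l, (1 : UnitQuat)) ∈ G := fun l hl =>
    mem_of_card_le_ker_toRight (by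
      rw [hL.card_eq, ← hS]; exact Nat.le_of_dvd Nat.card_pos hd) hl
  refine ⟨hmem, ?_⟩
  rintro ⟨l, r⟩ h
  refine hker1 r ?_
  simpa using G.mul_mem (G.inv_mem (hmem l ⟨_, h, rfl⟩)) h

/-- If every element with equal real parts is killed and one projection is icosahedral, there are
no pseudoreflections. -/
theorem free_of_isIcosahedral_left [Finite G] (hneg : ((-1, -1) : UnitQuat × UnitQuat) ∈ G)
    [Group.IsPerfect S] [Nontrivial S] {F : G →* S} (hF : Function.Surjective F)
    (hS : Nat.card S = 120) (hps : ∀ g : G, g.1.1.1.re = g.1.2.1.re → F g = 1)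
    (hL : IsIcosahedral (left G)) (g : G) (hg : g.1.1.1.re = g.1.2.1.re) :
    g.1.1 = 1 ∨ g.1.1 = -1 := by
  by_contra! hcon
  obtain ⟨hl1, hl2⟩ := hcon
  have hnegF : F ⟨_, hneg⟩ = 1 := hps _ rfl
  have hr1 : g.1.2 ≠ 1 := by
    rw [Ne, eq_one_iff_re, ← hg, ← eq_one_iff_re]; exact hl1
  have hr2 : g.1.2 ≠ -1 := by
    rw [Ne, eq_neg_one_iff_re, ← hg, ← eq_neg_one_iff_re]; exact hl2
  have hnL : (F.ker.map (toLeft G)).Normal :=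
    Subgroup.Normal.map inferInstance _ toLeft_surjective
  have hsL : Group.IsSolvable (left G ⧸ F.ker.map (toLeft G)) :=
    hL.isSolvable_quotient _ ⟨_, hnegF, rfl⟩ ⟨g, hps g hg, rfl⟩ hl1 hl2
  -- F is surjective on the elements whose left coordinate lies in the image of ker F; dividing such
  -- an element by one of ker F makes that coordinate 1 and keeps the value of F.
  have hker : (toLeft G).ker.map F = ⊤ := by
    rw [eq_top_iff, ← Group.IsPerfect.map_ker_eq_top hF
      ((QuotientGroup.mk' (F.ker.map (toLeft G))).comp (toLeft G))]
    rintro _ ⟨x, hx, rfl⟩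
    have hx' : toLeft G x ∈ F.ker.map (toLeft G) := (QuotientGroup.eq_one_iff _).1 hx
    obtain ⟨k, hk, hkx⟩ := hx'
    refine ⟨x * k⁻¹, ?_, ?_⟩
    · change toLeft G (x * k⁻¹) = 1
      rw [map_mul, map_inv, hkx, mul_inv_cancel]
    · have hk1 : F k = 1 := hk
      rw [map_mul, map_inv, hk1, inv_one, mul_one]
  obtain ⟨hd, hns⟩ := Group.IsPerfect.not_isSolvable_of_ker (toLeft G) (toRight G) hker
    eq_one_of_toLeft_of_toRight
  have hd' := hd.trans card_ker_toLeft_dvd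
  rw [hS] at hd'
  have hR : IsIcosahedral (right G) := by
    rcases isSolvable_or (neg_one_mem_right hneg) with h | h | h | h
    · exact absurd h hns
    · rw [h] at hd'; norm_num at hd'
    · rw [h] at hd'; norm_num at hd'
    · exact h
  have hmem : ∀ r ∈ right G, ((1 : UnitQuat), r) ∈ G := fun r hr =>
    mem_of_card_le_ker_toLeft (by
      rw [hR.card_eq, ← hS]; exact Nat.le_of_dvd Nat.card_pos hd) hr
  let f : right G →* S :=
    { toFun := fun r => F ⟨(1, r), hmem r r.2⟩
      map_one' := map_one F
      map_mul' := fun a b => by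
        rw [← map_mul]
        exact congrArg F (Subtype.ext (by simp)) }
  have hf : Function.Surjective f := by
    intro s
    have : s ∈ (toLeft G).ker.map F := by rw [hker]; trivial
    obtain ⟨x, hx, rfl⟩ := this
    exact ⟨toRight G x, congrArg F (Subtype.ext (Prod.ext (toLeft_eq_one.1 hx).symm rfl))⟩
  have hnR : (F.ker.map (toRight G)).Normal :=
    Subgroup.Normal.map inferInstance _ toRight_surjective
  have hsR : Group.IsSolvable (right G ⧸ F.ker.map (toRight G)) :=
    hR.isSolvable_quotient _ ⟨_, hnegF, rfl⟩ ⟨g, hps g hg, rfl⟩ hr1 hr2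
  have htop := Group.IsPerfect.map_ker_eq_top hf (QuotientGroup.mk' (F.ker.map (toRight G)))
  rw [QuotientGroup.ker_mk'] at htop
  -- Every a in S is F(1, r) for some k = (l, r) in ker F. Conjugation by (1, r) acts on 1 × R as
  -- conjugation by k does, and F(k) = 1, so a is central.
  have hcomm : ∀ a b : S, a * b = b * a := by
    intro a b
    have ha : a ∈ (F.ker.map (toRight G)).map f := by rw [htop]; trivial
    obtain ⟨_, ⟨k, hk, rfl⟩, rfl⟩ := ha
    obtain ⟨x, rfl⟩ := hf b
    have hk1 : F k = 1 := hk
    have e : (⟨(1, toRight G k), hmem _ (toRight G k).2⟩ : G) * ⟨(1, x), hmem x x.2⟩ =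
        k * ⟨(1, x), hmem x x.2⟩ * k⁻¹ * ⟨(1, toRight G k), hmem _ (toRight G k).2⟩ := by
      apply Subtype.ext
      apply Prod.ext
      · simp
      · simp [coe_toRight]
    change F ⟨(1, toRight G k), hmem _ (toRight G k).2⟩ * F ⟨(1, x), hmem x x.2⟩ =
      F ⟨(1, x), hmem x x.2⟩ * F ⟨(1, toRight G k), hmem _ (toRight G k).2⟩
    rw [← map_mul, e, map_mul, map_mul, map_mul, map_inv, hk1]
    simp
  exact Group.IsPerfect.not_isSolvable S (Group.isSolvable_of_comm hcomm)

end UnitQuat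

/-! ### Isometries of the quaternions -/

namespace UnitQuat

theorem mul_conj_mul (x v : ℍ[ℝ]) :
    v * star x * v = (2 * inner ℝ v x) • v - (‖v‖ ^ 2) • x := by
  have hN : ‖v‖ ^ 2 = v.re ^ 2 + v.imI ^ 2 + v.imJ ^ 2 + v.imK ^ 2 := by
    rw [sq, ← Quaternion.normSq_eq_norm_mul_self, Quaternion.normSq_def']
  rw [hN, Quaternion.inner_def]
  ext <;>
    simp only [Quaternion.re_mul, Quaternion.imI_mul, Quaternion.imJ_mul, Quaternion.imK_mul,
      Quaternion.re_star, Quaternion.imI_star, Quaternion.imJ_star, Quaternion.imK_star,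
      Quaternion.re_sub, Quaternion.imI_sub, Quaternion.imJ_sub, Quaternion.imK_sub,
      Quaternion.re_smul, Quaternion.imI_smul, Quaternion.imJ_smul, Quaternion.imK_smul,
      smul_eq_mul] <;>
    ring

/-- For a unit vector c, c x̄ c = 2⟨c, x⟩c - x is the negative of the reflection in the hyperplane
orthogonal to c. -/
theorem reflection_eq {v : ℍ[ℝ]} {c : UnitQuat} {s : ℝ} (hv : v ≠ 0) (hc : (c : ℍ[ℝ]) = s • v)
    (x : ℍ[ℝ]) : (ℝ ∙ v)ᗮ.reflection x = -((c : ℍ[ℝ]) * star x * c) := by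
  have hv' : ‖v‖ ≠ 0 := norm_ne_zero_iff.2 hv
  have hs : s ^ 2 * ‖v‖ ^ 2 = 1 := by
    have h := CStarRing.norm_of_mem_unitary c.2
    rw [hc, norm_smul] at h
    rw [← sq_abs s, ← Real.norm_eq_abs, ← mul_pow, h, one_pow]
  rw [Submodule.reflection_orthogonal_apply, Submodule.reflection_singleton_apply, hc,
    smul_mul_assoc, smul_mul_assoc, mul_smul_comm, mul_conj_mul, smul_sub, smul_sub, smul_smul,
    smul_smul, smul_smul, smul_smul, ← sq, hs, one_smul]
  have h : s ^ 2 = 1 / ‖v‖ ^ 2 := by field_simp; exact hs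
  rw [h, two_smul, ← add_smul]
  congr 3
  simp only [RCLike.ofReal_real_eq_id, id]
  ring

/-- Hyperplane reflections generate the orthogonal group, each has the form x ↦ l x̄ r⁻¹, and the
two forms are closed under composition and inverse. The determinant records which form occurs. -/
theorem isometry_eq (φ : ℍ[ℝ] ≃ₗᵢ[ℝ] ℍ[ℝ]) :
    (LinearMap.det φ.toLinearEquiv.toLinearMap = 1 ∧
      ∃ l r : UnitQuat, ∀ x, φ x = l * x * star (r : ℍ[ℝ])) ∨
    (LinearMap.det φ.toLinearEquiv.toLinearMap = -1 ∧
      ∃ l r : UnitQuat, ∀ x, φ x = l * star x * star (r : ℍ[ℝ])) := by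
  have hφ : φ ∈ Subgroup.closure (Set.range fun v : ℍ[ℝ] => (ℝ ∙ v)ᗮ.reflection) := by
    rw [LinearIsometryEquiv.reflections_generate]; trivial
  have hmul : ∀ a b : ℍ[ℝ] ≃ₗᵢ[ℝ] ℍ[ℝ],
      LinearMap.det (a * b).toLinearEquiv.toLinearMap =
        LinearMap.det a.toLinearEquiv.toLinearMap * LinearMap.det b.toLinearEquiv.toLinearMap :=
    fun a b => by rw [← LinearMap.det_comp]; rfl
  have hone : LinearMap.det (1 : ℍ[ℝ] ≃ₗᵢ[ℝ] ℍ[ℝ]).toLinearEquiv.toLinearMap = 1 :=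
    LinearMap.det_id
  induction hφ using Subgroup.closure_induction with
  | mem x hx =>
    obtain ⟨v, rfl⟩ := hx
    by_cases hv : v = 0
    · left
      have h1 : (ℝ ∙ v)ᗮ.reflection = 1 := by
        ext1 x
        exact Submodule.reflection_mem_subspace_eq_self (by simp [hv])
      simp only [h1]
      exact ⟨hone, 1, 1, fun x => by simp⟩
    · right
      obtain ⟨c, s, hc⟩ := exists_smul_eq hv
      refine ⟨?_, -c, c⁻¹, fun x => ?_⟩
      · have := (ℝ ∙ v)ᗮ.det_reflection
        rw [Submodule.orthogonal_orthogonal, finrank_span_singleton hv, pow_one] at this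
        exact this
      · simp only [reflection_eq hv hc]
        simp
  | one => exact Or.inl ⟨hone, 1, 1, fun x => by simp⟩
  | mul a b _ _ ha hb =>
    rw [hmul]
    rcases ha with ⟨da, l, r, ha⟩ | ⟨da, l, r, ha⟩ <;>
      rcases hb with ⟨db, l', r', hb⟩ | ⟨db, l', r', hb⟩
    · refine Or.inl ⟨by simp [da, db], l * l', r * r', fun x => ?_⟩
      simp [ha, hb, mul_assoc]
    · refine Or.inr ⟨by simp [da, db], l * l', r * r', fun x => ?_⟩
      simp [ha, hb, mul_assoc]
    · refine Or.inr ⟨by simp [da, db], l * r', r * l', fun x => ?_⟩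
      simp [ha, hb, mul_assoc]
    · refine Or.inl ⟨by simp [da, db], l * r', r * l', fun x => ?_⟩
      simp [ha, hb, mul_assoc]
  | inv a _ ha =>
    have hd := hmul a a⁻¹
    rw [mul_inv_cancel, hone] at hd
    have hl : ∀ q : UnitQuat, ∀ y : ℍ[ℝ], star (q : ℍ[ℝ]) * (q * y) = y := fun q y => by
      rw [← mul_assoc, Unitary.coe_star_mul_self, one_mul]
    have hi : ∀ x, a (a⁻¹ x) = x := fun x => a.apply_symm_apply x
    rcases ha with ⟨da, l, r, ha⟩ | ⟨da, l, r, ha⟩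
    · rw [da] at hd
      refine Or.inl ⟨by linarith, l⁻¹, r⁻¹, fun x => ?_⟩
      conv_rhs => rw [← hi x, ha]
      simp [mul_assoc, hl]
    · rw [da] at hd
      refine Or.inr ⟨by linarith, r⁻¹, l⁻¹, fun x => ?_⟩
      conv_rhs => rw [← hi x, ha]
      simp [mul_assoc, hl]

end UnitQuat

/-! ### The double cover of SO(4) -/

/-- The rotation of `ℝ⁴` given by a matrix of `SO(4)`. -/
noncomputable def Matrix.specialOrthogonalGroup.toIsometry {n : ℕ}
    (g : Matrix.specialOrthogonalGroup (Fin n) ℝ) :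
    EuclideanSpace ℝ (Fin n) ≃ₗᵢ[ℝ] EuclideanSpace ℝ (Fin n) :=
  ((Matrix.toEuclideanLin (g : Matrix (Fin n) (Fin n) ℝ)).isometryOfInner (fun x y => by
    rw [← LinearMap.adjoint_inner_right, ← Matrix.toEuclideanLin_conjTranspose_eq_adjoint,
      ← toEuclideanLin_mul_apply, ← Matrix.star_eq_conjTranspose,
      Matrix.mem_unitaryGroup_iff'.1 (Matrix.mem_specialOrthogonalGroup_iff.1 g.2).1,
      toEuclideanLin_one_apply])).toLinearIsometryEquiv rfl

theorem Matrix.det_toEuclideanLin {n : ℕ} (A : Matrix (Fin n) (Fin n) ℝ) :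
    LinearMap.det (Matrix.toEuclideanLin A) = A.det := by
  rw [Matrix.toEuclideanLin_eq_toLin_orthonormal, LinearMap.det_toLin]

namespace UnitQuat

/-- Under the identification `f`, the rotation `g` of `ℝ⁴` is the map `x ↦ l x r⁻¹`, where
`a = (l, r)`. -/
def Represents (f : ℍ[ℝ] ≃ₗᵢ[ℝ] EuclideanSpace ℝ (Fin 4)) (a : UnitQuat × UnitQuat)
    (g : Matrix.specialOrthogonalGroup (Fin 4) ℝ) : Prop :=
  ∀ x : ℍ[ℝ], Matrix.toEuclideanLin (g : Matrix (Fin 4) (Fin 4) ℝ) (f x) =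
    f ((a.1 : ℍ[ℝ]) * x * star (a.2 : ℍ[ℝ]))

variable {f : ℍ[ℝ] ≃ₗᵢ[ℝ] EuclideanSpace ℝ (Fin 4)}

theorem exists_represents (f : ℍ[ℝ] ≃ₗᵢ[ℝ] EuclideanSpace ℝ (Fin 4))
    (g : Matrix.specialOrthogonalGroup (Fin 4) ℝ) : ∃ a, Represents f a g := by
  let T := Matrix.specialOrthogonalGroup.toIsometry g
  have hT : ∀ x, T x = Matrix.toEuclideanLin (g : Matrix (Fin 4) (Fin 4) ℝ) x := fun x => rfl
  let φ : ℍ[ℝ] ≃ₗᵢ[ℝ] ℍ[ℝ] := (f.trans T).trans f.symm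
  have hφ : ∀ x, f (φ x) = Matrix.toEuclideanLin (g : Matrix (Fin 4) (Fin 4) ℝ) (f x) := by
    intro x
    rw [← hT]
    exact f.apply_symm_apply _
  have hdet : LinearMap.det φ.toLinearEquiv.toLinearMap = 1 := by
    rw [← (Matrix.mem_specialOrthogonalGroup_iff.1 g.2).2, ← Matrix.det_toEuclideanLin,
      ← LinearMap.det_conj φ.toLinearEquiv.toLinearMap f.toLinearEquiv]
    congr 1
    ext1 x
    have := hφ (f.symm x)
    rw [f.apply_symm_apply] at this
    exact this
  rcases isometry_eq φ with ⟨_, l, r, h⟩ | ⟨h, _⟩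
  · exact ⟨(l, r), fun x => by rw [← hφ, h]⟩
  · rw [hdet] at h; norm_num at h

theorem Represents.mul {a b : UnitQuat × UnitQuat}
    {g h : Matrix.specialOrthogonalGroup (Fin 4) ℝ} (ha : Represents f a g)
    (hb : Represents f b h) : Represents f (a * b) (g * h) := by
  intro x
  rw [Submonoid.coe_mul, toEuclideanLin_mul_apply, hb, ha]
  simp [mul_assoc]

theorem Represents.one : Represents f 1 1 := by
  intro x
  simp

theorem Represents.unique {a : UnitQuat × UnitQuat}
    {g h : Matrix.specialOrthogonalGroup (Fin 4) ℝ} (ha : Represents f a g)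
    (hb : Represents f a h) : g = h := by
  apply Subtype.ext
  apply Matrix.toEuclideanLin.injective
  ext1 y
  obtain ⟨x, rfl⟩ := f.surjective y
  rw [ha, hb]

theorem Represents.inv {a : UnitQuat × UnitQuat}
    {g : Matrix.specialOrthogonalGroup (Fin 4) ℝ} (ha : Represents f a g) :
    Represents f a⁻¹ g⁻¹ := by
  intro x
  have e : x = (a.1 : ℍ[ℝ]) * ((a⁻¹).1 * x * star ((a⁻¹).2 : ℍ[ℝ])) * star (a.2 : ℍ[ℝ]) := by
    have e1 : (a.1 : ℍ[ℝ]) * star (a.1 : ℍ[ℝ]) = 1 := Unitary.coe_mul_star_self a.1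
    have e2 : (a.2 : ℍ[ℝ]) * star (a.2 : ℍ[ℝ]) = 1 := Unitary.coe_mul_star_self a.2
    simp only [Prod.fst_inv, Prod.snd_inv, coe_inv, star_star]
    calc x = ((a.1 : ℍ[ℝ]) * star (a.1 : ℍ[ℝ])) * x * ((a.2 : ℍ[ℝ]) * star (a.2 : ℍ[ℝ])) := by
          rw [e1, e2, one_mul, mul_one]
      _ = _ := by simp only [mul_assoc]
  conv_lhs => rw [e, ← ha]
  rw [← toEuclideanLin_mul_apply, ← Submonoid.coe_mul, inv_mul_cancel]
  exact toEuclideanLin_one_apply _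

/-- Taking x = 1 gives l = r; then l commutes with i and j, so it is real. -/
theorem Represents.eq_or_of_one {a : UnitQuat × UnitQuat} (ha : Represents f a 1) :
    a = 1 ∨ a = (-1, -1) := by
  have h : ∀ x : ℍ[ℝ], x = (a.1 : ℍ[ℝ]) * x * star (a.2 : ℍ[ℝ]) := by
    intro x
    apply f.injective
    rw [← ha x]
    exact (toEuclideanLin_one_apply _).symm
  have h' : ∀ x : ℍ[ℝ], x * (a.2 : ℍ[ℝ]) = (a.1 : ℍ[ℝ]) * x := by
    intro x
    conv_lhs => rw [h x]
    rw [mul_assoc, Unitary.coe_star_mul_self, mul_one]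
  have h12 : a.2 = a.1 := by
    rw [← coe_inj]
    simpa using h' 1
  obtain ⟨i, i0, i1, i2, i3⟩ : ∃ i : ℍ[ℝ], i.re = 0 ∧ i.imI = 1 ∧ i.imJ = 0 ∧ i.imK = 0 :=
    ⟨⟨0, 1, 0, 0⟩, rfl, rfl, rfl, rfl⟩
  obtain ⟨j, j0, j1, j2, j3⟩ : ∃ j : ℍ[ℝ], j.re = 0 ∧ j.imI = 0 ∧ j.imJ = 1 ∧ j.imK = 0 :=
    ⟨⟨0, 0, 1, 0⟩, rfl, rfl, rfl, rfl⟩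
  have hI := h' i
  have hJ := h' j
  rw [h12] at hI hJ
  have e := congrArg QuaternionAlgebra.imK hI
  have e' := congrArg QuaternionAlgebra.imJ hI
  have e'' := congrArg QuaternionAlgebra.imK hJ
  simp only [Quaternion.imJ_mul, Quaternion.imK_mul, i0, i1, i2, i3, j0, j1, j2, j3] at e e' e''
  have hr : a.1.1.re ^ 2 = 1 := by
    have hs := sq_sum a.1
    have h2 : a.1.1.imI = 0 := by linarith
    have h3 : a.1.1.imJ = 0 := by linarith
    have h4 : a.1.1.imK = 0 := by linarith
    rw [h2, h3, h4] at hs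
    linarith
  rcases re_sq_eq_one_iff.1 hr with h1 | h1
  · exact Or.inl (Prod.ext h1 (h12.trans h1))
  · exact Or.inr (Prod.ext h1 (h12.trans h1))

theorem represents_neg_one : Represents f (-1, -1) 1 := by
  intro x
  simp

/-- The pairs of unit quaternions representing the elements of `Γ`. -/
def lift (f : ℍ[ℝ] ≃ₗᵢ[ℝ] EuclideanSpace ℝ (Fin 4))
    (Γ : Subgroup (Matrix.specialOrthogonalGroup (Fin 4) ℝ)) :
    Subgroup (UnitQuat × UnitQuat) where
  carrier := {a | ∃ g ∈ Γ, Represents f a g}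
  one_mem' := ⟨1, one_mem Γ, Represents.one⟩
  mul_mem' := by
    rintro a b ⟨g, hg, ha⟩ ⟨h, hh, hb⟩
    exact ⟨g * h, mul_mem hg hh, ha.mul hb⟩
  inv_mem' := by
    rintro a ⟨g, hg, ha⟩
    exact ⟨g⁻¹, inv_mem hg, ha.inv⟩

variable {Γ : Subgroup (Matrix.specialOrthogonalGroup (Fin 4) ℝ)}

theorem neg_one_mem_lift : ((-1, -1) : UnitQuat × UnitQuat) ∈ lift f Γ :=
  ⟨1, one_mem Γ, represents_neg_one⟩

/-- The projection of the lift of `Γ` onto `Γ`. -/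
noncomputable def proj (f : ℍ[ℝ] ≃ₗᵢ[ℝ] EuclideanSpace ℝ (Fin 4))
    (Γ : Subgroup (Matrix.specialOrthogonalGroup (Fin 4) ℝ)) : lift f Γ →* Γ :=
  MonoidHom.mk' (fun a => ⟨a.2.choose, a.2.choose_spec.1⟩) (fun a b => Subtype.ext
    ((a * b).2.choose_spec.2.unique (a.2.choose_spec.2.mul b.2.choose_spec.2)))

theorem represents_proj (a : lift f Γ) : Represents f a (proj f Γ a).1 :=
  a.2.choose_spec.2

theorem proj_eq {a : lift f Γ} {g : Γ} (h : Represents f a g.1) : proj f Γ a = g :=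
  Subtype.ext ((represents_proj a).unique h)

theorem proj_surjective : Function.Surjective (proj f Γ) := by
  intro g
  obtain ⟨a, ha⟩ := exists_represents f g.1
  exact ⟨⟨a, g.1, g.2, ha⟩, proj_eq ha⟩

theorem eq_or_of_proj_eq_one {a : lift f Γ} (h : proj f Γ a = 1) :
    a.1 = 1 ∨ a.1 = (-1, -1) := by
  have := represents_proj a
  rw [h] at this
  exact this.eq_or_of_one

instance [Finite Γ] : Finite (lift f Γ) := by
  have hk : Finite (proj f Γ).ker :=
    Finite.of_injective (β := ({1, (-1, -1)} : Set (UnitQuat × UnitQuat)))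
      (fun a => ⟨a.1.1, by simpa using eq_or_of_proj_eq_one a.2⟩)
      (fun a b h => Subtype.ext (Subtype.ext (Subtype.mk.inj h)))
  have hq : Finite (lift f Γ ⧸ (proj f Γ).ker) :=
    Finite.of_injective _ (QuotientGroup.kerLift_injective (proj f Γ))
  exact Finite.of_equiv _ (Subgroup.groupEquivQuotientProdSubgroup (s := (proj f Γ).ker)).symm

end UnitQuat

/-! ### Pseudoreflections in the double cover and the conclusion -/

namespace UnitQuat

variable {f : ℍ[ℝ] ≃ₗᵢ[ℝ] EuclideanSpace ℝ (Fin 4)} {a : UnitQuat × UnitQuat}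
  {g : Matrix.specialOrthogonalGroup (Fin 4) ℝ}

theorem Represents.fixed_iff (ha : Represents f a g) (x : ℍ[ℝ]) :
    Matrix.toEuclideanLin (g : Matrix (Fin 4) (Fin 4) ℝ) (f x) = f x ↔
      x * (a.2 : ℍ[ℝ]) = (a.1 : ℍ[ℝ]) * x := by
  rw [ha, f.injective.eq_iff]
  have e1 : (a.2 : ℍ[ℝ]) * star (a.2 : ℍ[ℝ]) = 1 := Unitary.coe_mul_star_self a.2
  have e2 : star (a.2 : ℍ[ℝ]) * (a.2 : ℍ[ℝ]) = 1 := Unitary.coe_star_mul_self a.2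
  constructor
  · intro h
    conv_lhs => rw [← h, mul_assoc, e2, mul_one]
  · intro h
    rw [← h, mul_assoc, e1, mul_one]

theorem eq_of_re_eq (h : a.1.1.re = a.2.1.re) (h1 : a.1 = 1 ∨ a.1 = -1) :
    a = 1 ∨ a = (-1, -1) := by
  rcases h1 with h1 | h1
  · left
    rw [h1] at h
    exact Prod.ext h1 (eq_one_iff_re.2 h.symm)
  · right
    rw [h1] at h
    exact Prod.ext h1 (eq_neg_one_iff_re.2 h.symm)

theorem Represents.eq_one_of (ha : Represents f a g) (h : a = 1 ∨ a = (-1, -1)) : g = 1 := by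
  rcases h with rfl | rfl
  · exact ha.unique Represents.one
  · exact ha.unique represents_neg_one

/-- The fixed vectors are the y with y r = l y. Equal real parts provide a nonzero such x, and the
others are x times the centralizer of r, which is the plane spanned by 1 and r. -/
theorem Represents.isPseudoreflection (ha : Represents f a g) (h : a.1.1.re = a.2.1.re)
    (h1 : a.1 ≠ 1) (h2 : a.1 ≠ -1) :
    IsPseudoreflection (Matrix.toEuclideanLin (g : Matrix (Fin 4) (Fin 4) ℝ)) := by
  have hr1 : a.2 ≠ 1 := fun e => h1 (eq_one_iff_re.2 (h.trans (eq_one_iff_re.1 e)))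
  have hr2 : a.2 ≠ -1 := fun e => h2 (eq_neg_one_iff_re.2 (h.trans (eq_neg_one_iff_re.1 e)))
  obtain ⟨x, hx, hxa⟩ := exists_intertwiner h.symm
  have hli : LinearIndependent ℝ ![f x, f (x * a.2)] := by
    rw [LinearIndependent.pair_iff]
    intro s t hst
    rw [← map_smul, ← map_smul, ← map_add, LinearIsometryEquiv.map_eq_zero_iff, ← mul_smul_comm,
      ← mul_one (s • x), smul_mul_assoc, ← mul_smul_comm, ← mul_add, mul_eq_zero] at hst
    have hst := hst.resolve_left hx
    have e0 := congrArg QuaternionAlgebra.re hst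
    have e1 := congrArg QuaternionAlgebra.imI hst
    have e2 := congrArg QuaternionAlgebra.imJ hst
    have e3 := congrArg QuaternionAlgebra.imK hst
    simp only [Quaternion.re_add, Quaternion.imI_add, Quaternion.imJ_add, Quaternion.imK_add,
      Quaternion.re_smul, Quaternion.imI_smul, Quaternion.imJ_smul, Quaternion.imK_smul,
      Quaternion.re_one, Quaternion.imI_one, Quaternion.imJ_one, Quaternion.imK_one,
      Quaternion.re_zero, Quaternion.imI_zero, Quaternion.imJ_zero, Quaternion.imK_zero,
      smul_eq_mul, mul_zero, zero_add, mul_one] at e0 e1 e2 e3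
    have ht : t = 0 := by
      by_contra ht
      have hs := sq_sum a.2
      rw [(mul_eq_zero.1 e1).resolve_left ht, (mul_eq_zero.1 e2).resolve_left ht,
        (mul_eq_zero.1 e3).resolve_left ht] at hs
      rcases re_sq_eq_one_iff.1 (by linarith) with e | e
      · exact hr1 e
      · exact hr2 e
    rw [ht, zero_mul, add_zero] at e0
    exact ⟨e0, ht⟩
  have hspan : LinearMap.eqLocus (Matrix.toEuclideanLin (g : Matrix (Fin 4) (Fin 4) ℝ))
      LinearMap.id = Submodule.span ℝ (Set.range ![f x, f (x * a.2)]) := by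
    rw [Matrix.range_cons, Matrix.range_cons, Matrix.range_empty, Set.union_empty,
      Set.singleton_union]
    ext y
    rw [Submodule.mem_span_pair]
    constructor
    · intro hy
      obtain ⟨y, rfl⟩ := f.surjective y
      have hy := (ha.fixed_iff y).1 hy
      have hz : (a.2 : ℍ[ℝ]) * (x⁻¹ * y) = x⁻¹ * y * (a.2 : ℍ[ℝ]) := by
        apply mul_left_cancel₀ hx
        rw [← mul_assoc, hxa, ← mul_assoc x (x⁻¹ * y), mul_inv_cancel_left₀ hx, hy, mul_assoc,
          mul_inv_cancel_left₀ hx]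
      obtain ⟨c, c1, c2, c3⟩ := exists_im_eq_of_commute hr1 hr2 hz
      refine ⟨(x⁻¹ * y).re - c * a.2.1.re, c, ?_⟩
      rw [← map_smul, ← map_smul, ← map_add]
      congr 1
      have : x⁻¹ * y = ((x⁻¹ * y).re - c * a.2.1.re) • (1 : ℍ[ℝ]) + c • (a.2 : ℍ[ℝ]) := by
        ext
        · simp
        · simpa using c1
        · simpa using c2
        · simpa using c3
      conv_rhs => rw [← mul_inv_cancel_left₀ hx y, this]
      rw [mul_add, mul_smul_comm, mul_smul_comm, mul_one]
    · rintro ⟨s, t, rfl⟩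
      rw [← map_smul, ← map_smul, ← map_add]
      refine (ha.fixed_iff _).2 ?_
      rw [add_mul, mul_add, smul_mul_assoc, smul_mul_assoc, mul_smul_comm, mul_smul_comm, hxa,
        mul_assoc, hxa]
  unfold IsPseudoreflection
  rw [hspan, finrank_span_eq_card hli]
  rfl

/-- A nonzero fixed vector x gives l = x r x⁻¹, and Re(xy) = Re(yx). -/
theorem Represents.re_eq_of_isPseudoreflection (ha : Represents f a g)
    (h : IsPseudoreflection (Matrix.toEuclideanLin (g : Matrix (Fin 4) (Fin 4) ℝ))) :
    a.1.1.re = a.2.1.re := by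
  have h' : 0 < Module.finrank ℝ (LinearMap.eqLocus
      (Matrix.toEuclideanLin (g : Matrix (Fin 4) (Fin 4) ℝ)) LinearMap.id) := by
    unfold IsPseudoreflection at h
    omega
  obtain ⟨⟨y, hy⟩, hy0⟩ := (Module.finrank_pos_iff_exists_ne_zero (R := ℝ)).1 h'
  obtain ⟨x, rfl⟩ := f.surjective y
  have hx : x ≠ 0 := by
    rintro rfl
    exact hy0 (Subtype.ext (map_zero f))
  have hxa := (ha.fixed_iff x).1 hy
  have e : (a.1 : ℍ[ℝ]) = x * (a.2 * x⁻¹) := by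
    rw [← mul_assoc, hxa, mul_assoc, mul_inv_cancel₀ hx, mul_one]
  have e' : (a.2 : ℍ[ℝ]) = a.2 * x⁻¹ * x := by rw [mul_assoc, inv_mul_cancel₀ hx, mul_one]
  rw [e]
  conv_rhs => rw [e']
  rw [Quaternion.re_mul x, Quaternion.re_mul _ x]
  ring

theorem not_isPseudoreflection_one : ¬ IsPseudoreflection (Matrix.toEuclideanLin
    ((1 : Matrix.specialOrthogonalGroup (Fin 4) ℝ) : Matrix (Fin 4) (Fin 4) ℝ)) := by
  intro h
  have e : LinearMap.eqLocus (Matrix.toEuclideanLin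
      ((1 : Matrix.specialOrthogonalGroup (Fin 4) ℝ) : Matrix (Fin 4) (Fin 4) ℝ))
      LinearMap.id = ⊤ := by
    rw [eq_top_iff]
    exact fun x _ => toEuclideanLin_one_apply x
  unfold IsPseudoreflection at h
  rw [e, finrank_top, finrank_euclideanSpace_fin] at h
  omega

theorem proj_mem_psSubgroup {Γ : Subgroup (Matrix.specialOrthogonalGroup (Fin 4) ℝ)}
    (b : lift f Γ) (h : b.1.1.1.re = b.1.2.1.re) : proj f Γ b ∈ psSubgroup Γ := by
  by_cases h1 : b.1.1 = 1 ∨ b.1.1 = -1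
  · have := (represents_proj b).eq_one_of (eq_of_re_eq h h1)
    have e : proj f Γ b = 1 := Subtype.ext this
    rw [e]
    exact one_mem _
  · rw [not_or] at h1
    exact Subgroup.subset_closure ((represents_proj b).isPseudoreflection h h1.1 h1.2)

theorem psSubgroup_eq_bot {Γ : Subgroup (Matrix.specialOrthogonalGroup (Fin 4) ℝ)}
    (h : ∀ b : lift f Γ, b.1.1.1.re = b.1.2.1.re → b.1.1 = 1 ∨ b.1.1 = -1) :
    psSubgroup Γ = ⊥ := by
  have : pseudoreflectionSet Γ = ∅ := by
    rw [Set.eq_empty_iff_forall_notMem]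
    intro g hg
    obtain ⟨b, rfl⟩ := proj_surjective (f := f) g
    have hre := (represents_proj b).re_eq_of_isPseudoreflection hg
    have e := (represents_proj b).eq_one_of (eq_of_re_eq hre (h b hre))
    apply not_isPseudoreflection_one
    rw [← e]
    exact hg
  rw [psSubgroup, this, Subgroup.closure_empty]

/-- The conjugate of l x̄ r̄ is r x l̄, so this change of identification exchanges the two factors.
-/
theorem Represents.comp_star {f' : ℍ[ℝ] ≃ₗᵢ[ℝ] EuclideanSpace ℝ (Fin 4)}
    (hf : ∀ x, f' x = f (star x)) : Represents f' a g ↔ Represents f a.swap g := by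
  constructor
  · intro h x
    have := h (star x)
    rw [hf, hf] at this
    simpa [mul_assoc] using this
  · intro h x
    have := h (star x)
    rw [hf, hf]
    simpa [mul_assoc] using this

theorem isPoincareGroup_of_left {Γ : Subgroup (Matrix.specialOrthogonalGroup (Fin 4) ℝ)}
    [Finite Γ] {S : Type*} [Group S] [Group.IsPerfect S] [Nontrivial S] (hS : Nat.card S = 120)
    (e : (Γ ⧸ psSubgroup Γ) ≃* S) (hL : IsIcosahedral (left (lift f Γ))) :
    IsPoincareGroup Γ := by
  let F : lift f Γ →* S := (e.toMonoidHom.comp (QuotientGroup.mk' _)).comp (proj f Γ)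
  have hF : Function.Surjective F :=
    (e.surjective.comp (QuotientGroup.mk'_surjective _)).comp proj_surjective
  have hF1 : ∀ b, F b = 1 ↔ proj f Γ b ∈ psSubgroup Γ := fun b => by
    change e (QuotientGroup.mk _) = 1 ↔ _
    rw [map_eq_one_iff _ e.injective, QuotientGroup.eq_one_iff]
  have hfree := free_of_isIcosahedral_left neg_one_mem_lift hF hS
    (fun b hb => (hF1 b).2 (proj_mem_psSubgroup b hb)) hL
  obtain ⟨h1, h2⟩ := right_trivial_of_free neg_one_mem_lift hF hS
    ((hF1 _).2 (proj_mem_psSubgroup _ rfl)) hfree (fun b hb => by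
      rw [hF1, psSubgroup_eq_bot hfree, Subgroup.mem_bot] at hb
      exact eq_or_of_proj_eq_one hb) hL
  obtain ⟨c, hc⟩ := hL.exists_conj_eq
  have hcc : ∀ y : ℍ[ℝ], (c : ℍ[ℝ]) * (star (c : ℍ[ℝ]) * y) = y := fun y => by
    rw [← mul_assoc, show (c : ℍ[ℝ]) * star (c : ℍ[ℝ]) = 1 from Unitary.coe_mul_star_self c,
      one_mul]
  have hcc' : ∀ y : ℍ[ℝ], star (c : ℍ[ℝ]) * ((c : ℍ[ℝ]) * y) = y := fun y => by
    rw [← mul_assoc, Unitary.coe_star_mul_self, one_mul]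
  -- Precomposing f with left multiplication by c̄ turns left multiplication by l into left
  -- multiplication by c l c⁻¹.
  let m : ℍ[ℝ] ≃ₗᵢ[ℝ] ℍ[ℝ] :=
    { toFun := fun x => star (c : ℍ[ℝ]) * x
      invFun := fun x => c * x
      map_add' := fun x y => mul_add _ _ _
      map_smul' := fun s x => mul_smul_comm _ _ _
      left_inv := hcc
      right_inv := hcc'
      norm_map' := fun x => by
        change ‖star (c : ℍ[ℝ]) * x‖ = ‖x‖
        rw [norm_mul, norm_star, CStarRing.norm_of_mem_unitary c.2, one_mul] }
  have hm : ∀ x, (m.trans f) x = f (star (c : ℍ[ℝ]) * x) := fun x => rfl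
  have hmem : ∀ l ∈ left (lift f Γ), c * l * c⁻¹ ∈ binaryIcosahedralGroup := fun l hl => by
    rw [← hc]
    exact ⟨l, hl, rfl⟩
  have hrep : ∀ {l : UnitQuat} {g}, Represents f (l, 1) g → ∀ x : ℍ[ℝ],
      Matrix.toEuclideanLin (g : Matrix (Fin 4) (Fin 4) ℝ) ((m.trans f) x) =
        (m.trans f) (((c * l * c⁻¹ : UnitQuat) : ℍ[ℝ]) * x) := by
    intro l g h x
    rw [hm, hm, h]
    simp [mul_assoc, hcc']
  refine ⟨m.trans f, fun g => ⟨fun hg => ?_, ?_⟩⟩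
  · obtain ⟨b, hb⟩ := exists_represents f g
    -- The pairs (l, -1) and (-l, 1) represent the same rotation.
    obtain ⟨l, hl⟩ : ∃ l, Represents f (l, 1) g := by
      rcases h2 b ⟨g, hg, hb⟩ with hb2 | hb2
      · exact ⟨b.1, by rw [← hb2]; exact hb⟩
      · refine ⟨-b.1, fun x => ?_⟩
        rw [hb, hb2]
        simp
    exact ⟨_, hmem l ⟨(l, 1), ⟨g, hg, hl⟩, rfl⟩, hrep hl⟩
  · rintro ⟨q, hq, h⟩
    rw [← hc] at hq
    obtain ⟨l, hl, rfl⟩ := hq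
    obtain ⟨g', hg', hl'⟩ := h1 l hl
    have : g = g' := by
      apply Subtype.ext
      apply Matrix.toEuclideanLin.injective
      ext1 y
      obtain ⟨x, rfl⟩ := (m.trans f).surjective y
      rw [h, hrep hl']
      rfl
    rw [this]
    exact hg'

theorem eq_five_and_isPoincareGroup {Γ : Subgroup (Matrix.specialOrthogonalGroup (Fin 4) ℝ)}
    [Finite Γ] {p : ℕ} (hp : p.Prime) (hp3 : 3 < p)
    (e : (Γ ⧸ psSubgroup Γ) ≃* Matrix.SpecialLinearGroup (Fin 2) (ZMod p)) :
    p = 5 ∧ IsPoincareGroup Γ := by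
  have := Fact.mk hp
  have := Matrix.SpecialLinearGroup.isPerfect_zmod p hp3
  have hdvd : p ∣ Nat.card (Matrix.SpecialLinearGroup (Fin 2) (ZMod p)) :=
    Matrix.SpecialLinearGroup.prime_dvd_card_zmod p
  have hnt : Nontrivial (Matrix.SpecialLinearGroup (Fin 2) (ZMod p)) := by
    rw [← Finite.one_lt_card_iff_nontrivial]
    exact hp.one_lt.trans_le (Nat.le_of_dvd Nat.card_pos hdvd)
  let f : ℍ[ℝ] ≃ₗᵢ[ℝ] EuclideanSpace ℝ (Fin 4) := Quaternion.linearIsometryEquivTuple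
  have hF : Function.Surjective
      ((e.toMonoidHom.comp (QuotientGroup.mk' (psSubgroup Γ))).comp (proj f Γ)) :=
    (e.surjective.comp (QuotientGroup.mk'_surjective _)).comp proj_surjective
  obtain ⟨rfl, hL⟩ := exists_isIcosahedral neg_one_mem_lift hF hp hp3 hdvd
  refine ⟨rfl, ?_⟩
  rcases hL with hL | hR
  · exact isPoincareGroup_of_left Matrix.SpecialLinearGroup.card_zmod_five e hL
  · let s : ℍ[ℝ] ≃ₗᵢ[ℝ] ℍ[ℝ] :=
      { toFun := star
        invFun := star
        map_add' := fun x y => star_add x y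
        map_smul' := fun c x => by simp
        left_inv := star_star
        right_inv := star_star
        norm_map' := norm_star }
    -- When the right projection is icosahedral, composing f with quaternionic conjugation makes it
    -- the left one.
    refine isPoincareGroup_of_left (f := s.trans f) Matrix.SpecialLinearGroup.card_zmod_five e ?_
    have hs : ∀ {a g}, Represents (s.trans f) a g ↔ Represents f a.swap g :=
      Represents.comp_star fun x => rfl
    have : left (lift (s.trans f) Γ) = right (lift f Γ) := by
      ext q
      constructor
      · rintro ⟨b, ⟨g, hg, hb⟩, rfl⟩
        exact ⟨b.swap, ⟨g, hg, hs.1 hb⟩, rfl⟩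
      · rintro ⟨b, ⟨g, hg, hb⟩, rfl⟩
        exact ⟨b.swap, ⟨g, hg, hs.2 hb⟩, rfl⟩
    rw [this]
    exact hR

end UnitQuat

theorem mainTheorem10 (Γ : Subgroup (Matrix.specialOrthogonalGroup (Fin 4) ℝ)) [Finite Γ]
    (p : ℕ) (hp : p.Prime) (hp3 : 3 < p)
    (hΓ : Nonempty ((Γ ⧸ psSubgroup Γ) ≃* Matrix.SpecialLinearGroup (Fin 2) (ZMod p))) :
    p = 5 ∧ IsPoincareGroup Γ :=
  hΓ.elim (UnitQuat.eq_five_and_isPoincareGroup hp hp3)
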